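/- **Theorem 4.4 (planar area estimate).** Let $(X,\|\cdot\|)$ be a two-dimensional real normed space that is strictly convex and whose unit circle $S=\{x:\|x\|=1\}$ is a smooth ($C^\infty$) regular curve, and let $\varphi:\mathbb R\to X$ be a smooth parametrization of $S$ by norm arc length. Fix a nondegenerate symplectic (alternating bilinear) form $\omega$ on $X$. Let $\lambda$ be the area measure induced by $\omega$ (the parallelogram spanned by $x,y$ has area $|\omega(x,y)|$), and let $\|x\|_a=\sup\{\omega(x,y):y\in S\}$ be the anti-norm. If $c(u)$ is a smooth curve parametrized by norm arc length and $t(u)$ is a smooth real function with $c'(u)=\varphi'(t(u))$ for all $u$, then the circular curvature of $c$ at $c(u)$ (with respect to $\varphi$) is $t'(u)$. For a regular curve in another parametrization, the circular curvature at a point is the one obtained after an orientation-preserving smooth reparametrization by norm arc length. (When the curvature of $S$ vanishes nowhere, such a function $t$ always exists.) Let $\gamma$ be a closed, smooth ($C^\infty$), simple curve in $X$, parametrized by arc length $s$ in the anti-norm, i.e. $\|\gamma'(s)\|_a=1$, with length $l_a(\gamma)$ in the anti-norm (so $\gamma$ extends to a smooth $l_a(\gamma)$-periodic map on $\mathbb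 R$ that is injective on $[0,l_a(\gamma))$). Assume that $\gamma$ has a circular curvature $k_c(s)$ (in the norm $\|\cdot\|$) and that $k_c(s)>0$ for every $s$. Let $D$ be the region enclosed by $\gamma$, i.e. the set of points off the curve whose connected component in the complement of the curve is bounded. Then $$2\lambda(D)\le\int_0^{l_a(\gamma)}\frac{1}{k_c(s)}\,ds ,$$ and equality holds if and only if $\gamma$ is a circle of the norm, i.e. its image is $\{x:\|x-p\|=r\}$ for some $p\in X$ and $r>0$. -/

import Mathlib

open scoped ContDiff

noncomputable section

namespace NormedPlane

/-- The anti-norm `‖x‖ₐ = sup {Ω(x, y) : ‖y‖ = 1}` induced by the area form `Ω`. A nonzero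
alternating 2-form on a 2-dimensional space is the same as a nondegenerate symplectic form. -/
def antinorm {X : Type*} [NormedAddCommGroup X] [NormedSpace ℝ X]
    (Ω : X [⋀^Fin 2]→ₗ[ℝ] ℝ) (x : X) : ℝ :=
  sSup ((fun y : X => Ω ![x, y]) '' Metric.sphere (0 : X) 1)

/-- `φ` is a smooth parametrization by (norm) arc length of the unit circle. The existence of
such a `φ` says that the unit circle is a smooth regular curve. Either orientation is allowed. -/
structure IsUnitCircleParam {X : Type*} [NormedAddCommGroup X] [NormedSpace ℝ X]
    (φ : ℝ → X) : Prop where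
  smooth : ContDiff ℝ ∞ φ
  range_eq : Set.range φ = Metric.sphere (0 : X) 1
  unit_speed : ∀ t, ‖deriv φ t‖ = 1

/-- `k` is the circular curvature of the smooth curve `c`, parametrized by norm arc length, with
respect to the arc-length parametrization `φ` of the unit circle: there is a smooth function `t`
with `c'(u) = φ'(t(u))`, and `k(u) = t'(u)`. -/
def IsCircularCurvatureArcLength {X : Type*} [NormedAddCommGroup X] [NormedSpace ℝ X]
    (φ c : ℝ → X) (k : ℝ → ℝ) : Prop :=
  ∃ t : ℝ → ℝ, ContDiff ℝ ∞ t ∧ (∀ u, deriv c u = deriv φ (t u)) ∧ ∀ u, k u = deriv t u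

/-- `k` is the circular curvature (in the norm) of the regular curve `γ` in an arbitrary
parametrization: `γ = c ∘ σ`, where `c` is a parametrization by norm arc length with the same
orientation, and `k(s)` is the circular curvature of `c` at the parameter `σ(s)`. -/
def IsCircularCurvature {X : Type*} [NormedAddCommGroup X] [NormedSpace ℝ X]
    (φ γ : ℝ → X) (k : ℝ → ℝ) : Prop :=
  ∃ (c : ℝ → X) (σ κ : ℝ → ℝ),
    ContDiff ℝ ∞ c ∧ (∀ u, ‖deriv c u‖ = 1) ∧
    ContDiff ℝ ∞ σ ∧ (∀ s, 0 < deriv σ s) ∧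
    (∀ s, γ s = c (σ s)) ∧
    IsCircularCurvatureArcLength φ c κ ∧
    ∀ s, k s = κ (σ s)

/-- `γ` is a smooth simple closed curve, parametrized by arc length in the anti-norm; it is
given as an `L`-periodic map, and `L` is its length in the anti-norm. -/
structure IsSimpleClosedAntinormCurve {X : Type*} [NormedAddCommGroup X] [NormedSpace ℝ X]
    (Ω : X [⋀^Fin 2]→ₗ[ℝ] ℝ) (γ : ℝ → X) (L : ℝ) : Prop where
  length_pos : 0 < L
  smooth : ContDiff ℝ ∞ γ
  periodic : Function.Periodic γ L
  simple : Set.InjOn γ (Set.Ico 0 L)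
  unit_speed : ∀ s, antinorm Ω (deriv γ s) = 1

/-- The region enclosed by `Γ`: the points off `Γ` whose connected component in the complement
of `Γ` is bounded. -/
def enclosedRegion {X : Type*} [NormedAddCommGroup X] (Γ : Set X) : Set X :=
  {x | x ∉ Γ ∧ Bornology.IsBounded (connectedComponentIn Γᶜ x)}

end NormedPlane

end

namespace NormedPlane

open Set Filter Topology MeasureTheory

/-! The proof is of Heintze–Karcher type. Choose linear coordinates in which the area form is
standard up to sign and the unit circle is positively oriented, and write γ' = ς φ'(θ). Anti-norm
arc length then means ς ω(φ, φ') = 1 along θ, so the inner normal map (s, q) ↦ γ(s) - q φ(θ(s)) has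
Jacobian of absolute value |1 - q k(s)|.

Every enclosed point x lies on the inner normal at a nearest point γ(s), at distance r say, and r
obeys two bounds: r ≤ 1/k(s), as no focal point comes earlier (`mul_curvature_le_one`), and r ≤ R =
L / ∫ k, by a Minkowski-type formula (`mul_integral_curvature_le`). Both use that the curve lies on
one side of each tangent line (`crossForm_sub_nonpos`). This convexity comes from Hopf's secant
argument: positive curvature makes the tangent angle increase, and simplicity makes it increase by
exactly 2π per period.

With m = min(R, 1/k), integrating the Jacobian gives λ(D) ≤ ∫ (m - m²k/2). Completing the square
turns this into ∫ 1/k - 2λ(D) ≥ ∫ k (1/k - m)² ≥ 0. The cut at 1/k alone would prove the inequality;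
the cut at R settles equality. It forces 1/k ≤ R, while ∫ (Rk - 1) = 0, so Rk = 1 and γ - R φ(θ) is
constant. Conversely, on a circle the normal map is injective before the center, and the area
formula gives the reverse bound. -/

/-- The standard area form of `ℝ × ℝ`. -/
def cross (z w : ℝ × ℝ) : ℝ := z.1 * w.2 - z.2 * w.1

/-! ### Tangents of the unit circle as supporting functionals -/

section Support

variable {X : Type*} [NormedAddCommGroup X] [NormedSpace ℝ X]

/-- The area form transported to `X` by `e`, as a linear form in its first argument. -/
noncomputable def crossForm (e : X ≃L[ℝ] ℝ × ℝ) (y : X) : X →L[ℝ] ℝ :=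
  (e y).2 • (ContinuousLinearMap.fst ℝ ℝ ℝ).comp (e : X →L[ℝ] ℝ × ℝ) -
    (e y).1 • (ContinuousLinearMap.snd ℝ ℝ ℝ).comp (e : X →L[ℝ] ℝ × ℝ)

theorem crossForm_apply (e : X ≃L[ℝ] ℝ × ℝ) (x y : X) :
    crossForm e y x = cross (e x) (e y) := by
  simp [crossForm, cross]; ring

theorem crossForm_smul (e : X ≃L[ℝ] ℝ × ℝ) (a : ℝ) (y : X) :
    crossForm e (a • y) = a • crossForm e y := by
  ext x; simp [crossForm_apply, cross]; ring

theorem crossForm_swap (e : X ≃L[ℝ] ℝ × ℝ) (x y : X) :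
    crossForm e y x = - crossForm e x y := by
  simp [crossForm_apply, cross]; ring

/-- Cramer's rule: the linear relation between three vectors of a plane. -/
theorem crossForm_decomp (e : X ≃L[ℝ] ℝ × ℝ) (a b x : X) :
    crossForm e b a • x = crossForm e b x • a + crossForm e x a • b := by
  apply e.injective
  ext <;> simp [crossForm_apply, cross] <;> ring

theorem continuous_crossForm (e : X ≃L[ℝ] ℝ × ℝ) {ι : Type*} [TopologicalSpace ι] {f g : ι → X}
    (hf : Continuous f) (hg : Continuous g) : Continuous fun i => crossForm e (g i) (f i) := by
  simp only [crossForm_apply, cross]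
  fun_prop

/-- `φ` is a `C¹` positively oriented parametrization of the unit circle, with derivative `φ'`. -/
structure IsOrientedCircle (e : X ≃L[ℝ] ℝ × ℝ) (φ φ' : ℝ → X) : Prop where
  hasDerivAt : ∀ t, HasDerivAt φ (φ' t) t
  continuous_deriv : Continuous φ'
  norm_eq : ∀ t, ‖φ t‖ = 1
  surj : ∀ x, ‖x‖ = 1 → ∃ t, φ t = x
  pos : ∀ t, 0 < crossForm e (φ' t) (φ t)

/-- A supporting functional at a point of the unit circle is proportional to the area form
against the tangent vector. -/
theorem crossForm_deriv_support (e : X ≃L[ℝ] ℝ × ℝ) {φ φ' : ℝ → X}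
    (hd : ∀ t, HasDerivAt φ (φ' t) t) (hn : ∀ t, ‖φ t‖ = 1) (h0 : ∀ t, φ' t ≠ 0) (u : ℝ) :
    crossForm e (φ' u) (φ u) ≠ 0 ∧
      ∀ x, |crossForm e (φ' u) x| ≤ |crossForm e (φ' u) (φ u)| * ‖x‖ := by
  have hne : φ u ≠ 0 := by rw [← norm_ne_zero_iff, hn]; norm_num
  obtain ⟨g, hg, hgu⟩ := exists_dual_vector ℝ (φ u) (by simp [hne])
  have hgu' : g (φ u) = 1 := by simpa [hn] using hgu
  have hgle : ∀ x, |g x| ≤ ‖x‖ := fun x => by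
    have := g.le_opNorm x
    rw [hg, one_mul] at this
    simpa using this
  -- The norming functional `g` is maximal on the unit circle at `φ u`, so it kills the tangent
  -- there; in dimension two this determines it up to a factor.
  have hg' : g (φ' u) = 0 := by
    have hm : IsLocalMax (fun t => g (φ t)) u := by
      refine Eventually.of_forall fun t => ?_
      have := (le_abs_self _).trans (hgle (φ t))
      rw [hn] at this
      simpa [hgu'] using this
    exact hm.hasDerivAt_eq_zero (g.hasFDerivAt.comp_hasDerivAt u (hd u))
  have key : ∀ x, crossForm e (φ' u) (φ u) * g x = crossForm e (φ' u) x := fun x => by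
    have := congrArg g (crossForm_decomp e (φ u) (φ' u) x)
    simpa [hgu', hg'] using this
  constructor
  · intro hw
    apply h0 u
    have h1 := key (e.symm (1, 0))
    have h2 := key (e.symm (0, 1))
    rw [hw, zero_mul] at h1 h2
    apply e.injective
    simp only [crossForm_apply, cross, ContinuousLinearEquiv.apply_symm_apply] at h1 h2
    ext <;> simp <;> linarith
  · intro x
    rw [← key, abs_mul]
    exact mul_le_mul_of_nonneg_left (hgle x) (abs_nonneg _)

namespace IsOrientedCircle

variable {e : X ≃L[ℝ] ℝ × ℝ} {φ φ' : ℝ → X}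

theorem continuous (h : IsOrientedCircle e φ φ') : Continuous φ :=
  continuous_iff_continuousAt.2 fun t => (h.hasDerivAt t).continuousAt

theorem deriv_ne_zero (h : IsOrientedCircle e φ φ') (t : ℝ) : φ' t ≠ 0 := fun h0 => by
  have := h.pos t
  simp [h0, crossForm_apply, cross] at this

theorem crossForm_le (h : IsOrientedCircle e φ φ') (u : ℝ) (x : X) :
    crossForm e (φ' u) x ≤ crossForm e (φ' u) (φ u) * ‖x‖ := by
  have := (crossForm_deriv_support e h.hasDerivAt h.norm_eq h.deriv_ne_zero u).2 x
  rw [abs_of_pos (h.pos u)] at this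
  exact (le_abs_self _).trans this

/-- The functional attains its bound at `x` and at `‖x‖ • φ u`, hence at their sum. The triangle
inequality is then an equality, and strict convexity applies. -/
theorem eq_of_le_crossForm [StrictConvexSpace ℝ X] (h : IsOrientedCircle e φ φ') {u : ℝ} {x : X}
    (hx : crossForm e (φ' u) (φ u) * ‖x‖ ≤ crossForm e (φ' u) x) : x = ‖x‖ • φ u := by
  have hw := h.pos u
  have h1 := h.crossForm_le u (x + ‖x‖ • φ u)
  have h2 : ‖‖x‖ • φ u‖ = ‖x‖ := by rw [norm_smul, h.norm_eq]; simp
  apply eq_of_norm_eq_of_norm_add_eq h2.symm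
  apply le_antisymm (norm_add_le _ _)
  rw [h2]
  simp only [map_add, map_smul, smul_eq_mul] at h1
  by_contra hlt
  push Not at hlt
  nlinarith

/-- The tangent vectors just after `u` lie to the left of `φ' u`. -/
theorem crossForm_deriv_neg_right [StrictConvexSpace ℝ X] (h : IsOrientedCircle e φ φ') (u : ℝ) :
    ∀ᶠ v in 𝓝[>] u, crossForm e (φ' u) (φ' v) < 0 := by
  -- If the tangents at `v` near `u` were parallel, they would be positively proportional, so both
  -- points would maximize the same functional and coincide; but `φ` avoids the value `φ u` near
  -- `u`.
  have hne : ∀ᶠ v in 𝓝[≠] u, crossForm e (φ' u) (φ' v) ≠ 0 := by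
    have h1 : ∀ᶠ v in 𝓝[≠] u, φ v ≠ φ u := (h.hasDerivAt u).eventually_ne (h.deriv_ne_zero u)
    have h2 : ∀ᶠ v in 𝓝[≠] u, 0 < crossForm e (φ' u) (φ v) := by
      apply eventually_nhdsWithin_of_eventually_nhds
      exact (continuous_crossForm e h.continuous continuous_const).continuousAt.eventually
        (lt_mem_nhds (h.pos u))
    filter_upwards [h1, h2] with v hv1 hv2 h0
    have hpar := crossForm_decomp e (φ v) (φ' v) (φ' u)
    rw [crossForm_swap e (φ' u) (φ' v), h0, neg_zero, zero_smul, zero_add] at hpar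
    have hwv := h.pos v
    set a := crossForm e (φ' u) (φ v) / crossForm e (φ' v) (φ v) with ha
    have ha0 : 0 < a := div_pos hv2 hwv
    have hpar' : φ' u = a • φ' v := by
      rw [ha, div_eq_inv_mul, mul_smul, ← hpar, smul_smul, inv_mul_cancel₀ hwv.ne', one_smul]
    apply hv1
    have hx := h.eq_of_le_crossForm (u := v) (x := φ u) (by
      have := h.crossForm_le u (φ v)
      rw [hpar', crossForm_smul] at this
      simp only [smul_apply, smul_eq_mul, h.norm_eq] at this ⊢
      nlinarith)
    rw [hx, h.norm_eq, one_smul]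
  have hd : ∀ v, HasDerivAt (fun v => crossForm e (φ' u) (φ v)) (crossForm e (φ' u) (φ' v)) v :=
    fun v => (crossForm e (φ' u)).hasFDerivAt.comp_hasDerivAt v (h.hasDerivAt v)
  have hmax : ∀ v, crossForm e (φ' u) (φ v) ≤ crossForm e (φ' u) (φ u) := fun v => by
    simpa [h.norm_eq] using h.crossForm_le u (φ v)
  have hcont : Continuous fun v => crossForm e (φ' u) (φ' v) :=
    continuous_crossForm e h.continuous_deriv continuous_const
  have hcφ : Continuous fun v => crossForm e (φ' u) (φ v) :=
    continuous_crossForm e h.continuous continuous_const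
  rw [eventually_nhdsWithin_iff, Metric.eventually_nhds_iff] at hne
  obtain ⟨δ, hδ, hne⟩ := hne
  have hne' : ∀ v, |v - u| < δ → v ≠ u → crossForm e (φ' u) (φ' v) ≠ 0 := fun v hv hvu =>
    hne (by simpa [Real.dist_eq] using hv) hvu
  filter_upwards [Ioo_mem_nhdsGT (show u < u + δ by linarith)] with v hv
  by_contra hcon
  push Not at hcon
  -- The derivative has no zero just after `u`, so it keeps its sign. A positive sign would make the
  -- height grow beyond its maximum, which is at `u`.
  have hposi : ∀ x ∈ Ioo u v, 0 < crossForm e (φ' u) (φ' x) := by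
    intro x hx
    by_contra hc
    push Not at hc
    obtain ⟨y, hy, hy0⟩ := intermediate_value_Icc hx.2.le hcont.continuousOn ⟨hc, hcon⟩
    exact hne' y (by rw [abs_lt]; constructor <;> linarith [hy.1, hy.2, hx.1, hv.2])
      (by linarith [hy.1, hx.1] : u < y).ne' hy0
  have hmono : StrictMonoOn (fun v => crossForm e (φ' u) (φ v)) (Icc u v) :=
    strictMonoOn_of_deriv_pos (convex_Icc _ _) hcφ.continuousOn (fun x hx => by
      rw [interior_Icc] at hx
      rw [(hd x).deriv]
      exact hposi x hx)
  exact absurd (hmono (left_mem_Icc.2 hv.1.le) (right_mem_Icc.2 hv.1.le) hv.1)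
    (not_lt.2 (hmax v))

/-- Points of the unit circle with positively proportional tangent vectors coincide. -/
theorem eq_of_deriv_eq_smul [StrictConvexSpace ℝ X] (h : IsOrientedCircle e φ φ') {u v a : ℝ}
    (ha : 0 < a) (huv : φ' u = a • φ' v) : φ u = φ v := by
  have hx := h.eq_of_le_crossForm (u := v) (x := φ u) (by
    have := h.crossForm_le u (φ v)
    rw [huv, crossForm_smul] at this
    simp only [smul_apply, smul_eq_mul, h.norm_eq] at this ⊢
    nlinarith)
  rwa [h.norm_eq, one_smul] at hx

end IsOrientedCircle

end Support

/-! ### Hopf's secant argument -/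

/-- Average of `γ'` over the segment from `s` to `s + q`. -/
noncomputable def meanVelocity (γ' : ℝ → ℂ) (s q : ℝ) : ℂ := ∫ x in (0:ℝ)..1, γ' (s + x * q)

theorem continuous_meanVelocity {γ' : ℝ → ℂ} (hc : Continuous γ') :
    Continuous fun p : ℝ × ℝ => meanVelocity γ' p.1 p.2 := by
  unfold meanVelocity
  apply intervalIntegral.continuous_parametric_intervalIntegral_of_continuous'
  fun_prop

theorem smul_meanVelocity {γ γ' : ℝ → ℂ} (hd : ∀ s, HasDerivAt γ (γ' s) s) (hc : Continuous γ')
    (s q : ℝ) : q • meanVelocity γ' s q = γ (s + q) - γ s := by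
  have hd' : ∀ x ∈ uIcc (0:ℝ) 1, HasDerivAt (fun x => γ (s + x * q)) (q • γ' (s + x * q)) x := by
    intro x _
    have := (hd (s + x * q)).scomp x (((hasDerivAt_id x).mul_const q).const_add s)
    simpa [Function.comp_def] using this
  have := intervalIntegral.integral_eq_sub_of_hasDerivAt hd'
    (Continuous.intervalIntegrable (by fun_prop) _ _)
  rw [intervalIntegral.integral_smul] at this
  simpa [meanVelocity] using this

theorem meanVelocity_zero (γ' : ℝ → ℂ) (s : ℝ) : meanVelocity γ' s 0 = γ' s := by
  simp [meanVelocity]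

/-- The secant map of a closed curve of period `L`: a positive multiple of `γ (s + q) - γ s`,
extended continuously to `q = 0` and `q = L`. -/
noncomputable def secant (γ' : ℝ → ℂ) (L s q : ℝ) : ℂ :=
  meanVelocity γ' s q - meanVelocity γ' (s + q) (L - q)

theorem continuous_secant {γ' : ℝ → ℂ} (hc : Continuous γ') (L : ℝ) :
    Continuous fun p : ℝ × ℝ => secant γ' L p.1 p.2 := by
  unfold secant
  have h := continuous_meanVelocity hc
  exact h.sub (h.comp (f := fun p : ℝ × ℝ => (p.1 + p.2, L - p.2)) (by fun_prop))

theorem secant_eq {γ γ' : ℝ → ℂ} {L : ℝ} (hd : ∀ s, HasDerivAt γ (γ' s) s)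
    (hc : Continuous γ') (hp : Function.Periodic γ L) {s q : ℝ} (hq : 0 < q) (hqL : q < L) :
    secant γ' L s q = (q⁻¹ + (L - q)⁻¹) • (γ (s + q) - γ s) := by
  have h1 := smul_meanVelocity hd hc s q
  have h2 := smul_meanVelocity hd hc (s + q) (L - q)
  rw [show s + q + (L - q) = s + L by ring, hp s] at h2
  have h1' : meanVelocity γ' s q = q⁻¹ • (γ (s + q) - γ s) := by
    rw [← h1, inv_smul_smul₀ hq.ne']
  have h2' : meanVelocity γ' (s + q) (L - q) = (L - q)⁻¹ • (γ s - γ (s + q)) := by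
    rw [← h2, inv_smul_smul₀ (sub_pos.2 hqL).ne']
  rw [secant, h1', h2', add_smul, ← neg_sub (γ (s + q)), smul_neg, sub_neg_eq_add]

theorem secant_zero {γ γ' : ℝ → ℂ} {L : ℝ} (hL : 0 < L) (hd : ∀ s, HasDerivAt γ (γ' s) s)
    (hc : Continuous γ') (hp : Function.Periodic γ L) (s : ℝ) : secant γ' L s 0 = γ' s := by
  have h := smul_meanVelocity hd hc s L
  rw [hp s, sub_self] at h
  -- The mean velocity over a full period vanishes, so only the other average survives.
  have h' := (smul_eq_zero.1 h).resolve_left hL.ne'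
  simp [secant, meanVelocity_zero, h']

theorem secant_period {γ γ' : ℝ → ℂ} {L : ℝ} (hL : 0 < L) (hd : ∀ s, HasDerivAt γ (γ' s) s)
    (hc : Continuous γ') (hp : Function.Periodic γ L) (s : ℝ) :
    secant γ' L s L = - γ' (s + L) := by
  have h := smul_meanVelocity hd hc s L
  rw [hp s, sub_self] at h
  have h' := (smul_eq_zero.1 h).resolve_left hL.ne'
  simp [secant, meanVelocity_zero, h']

/-- A simple closed curve given as a periodic map takes different values at parameters whose
distance is less than the period. -/
theorem ne_of_injOn_period {E : Type*} {γ : ℝ → E} {L : ℝ} (hL : 0 < L)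
    (hp : Function.Periodic γ L) (hi : InjOn γ (Ico 0 L)) {s q : ℝ} (hq : 0 < q) (hqL : q < L) :
    γ (s + q) ≠ γ s := by
  intro h
  have e1 : γ (toIcoMod hL 0 (s + q)) = γ (s + q) := by
    rw [toIcoMod]; exact hp.sub_zsmul_eq _
  have e2 : γ (toIcoMod hL 0 s) = γ s := by
    rw [toIcoMod]; exact hp.sub_zsmul_eq _
  have m1 := toIcoMod_mem_Ico hL 0 (s + q)
  have m2 := toIcoMod_mem_Ico hL 0 s
  rw [zero_add] at m1 m2
  have := hi m1 m2 (by rw [e1, e2, h])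
  rw [toIcoMod_eq_toIcoMod] at this
  obtain ⟨n, hn⟩ := this
  rw [zsmul_eq_mul] at hn
  have h3 : (n : ℝ) * L = -q := by linarith
  have h4 : (n : ℝ) < 0 := by nlinarith
  have h5 : (-1 : ℝ) < n := by nlinarith
  have : n < 0 := by exact_mod_cast h4
  have : (-1) < n := by exact_mod_cast h5
  omega

/-- While the cosine of a continuous angle keeps its sign, the angle changes by at most `π`. -/
theorem sub_le_pi_of_cos_nonneg {b : ℝ → ℝ} (hb : Continuous b) {ε x y : ℝ} (hε : ε ≠ 0)
    (h : ∀ q ∈ uIcc x y, 0 ≤ ε * Real.cos (b q)) : b y - b x ≤ Real.pi := by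
  by_contra! hlt
  have hval : ∀ c ∈ Icc (b x) (b y), 0 ≤ ε * Real.cos c := by
    intro c hc
    obtain ⟨q, hq, rfl⟩ := intermediate_value_uIcc hb.continuousOn (Icc_subset_uIcc hc)
    exact h q hq
  have hpi := Real.pi_pos
  -- The cosine takes opposite values at `c` and `c + π`, so the sign condition at both forces a
  -- zero. A range longer than `π` gives two such zeros at distance `d < π`, which is impossible.
  have hz : ∀ c, b x ≤ c → c + Real.pi ≤ b y → Real.cos c = 0 := by
    intro c h1 h2
    have e1 := hval c ⟨h1, by linarith⟩
    have e2 := hval (c + Real.pi) ⟨by linarith, h2⟩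
    rw [Real.cos_add_pi] at e2
    have : ε * Real.cos c = 0 := by linarith
    exact (mul_eq_zero.1 this).resolve_left hε
  set d := min 1 (b y - b x - Real.pi)
  have hd0 : 0 < d := lt_min one_pos (by linarith)
  have hd1 : d ≤ 1 := min_le_left _ _
  have hd2 : d ≤ b y - b x - Real.pi := min_le_right _ _
  have c0 := hz (b x) le_rfl (by linarith)
  have c1 := hz (b x + d) (by linarith) (by linarith)
  rw [Real.cos_add, c0, zero_mul, zero_sub, neg_eq_zero] at c1
  have hs : 0 < Real.sin d := Real.sin_pos_of_pos_of_lt_pi hd0 (by linarith [Real.pi_gt_three])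
  have h0 := (mul_eq_zero.1 c1).resolve_right hs.ne'
  have := Real.sin_sq_add_cos_sq (b x)
  rw [h0, c0] at this
  norm_num at this

/-- Hopf's secant argument: the tangent of a simple closed curve has a continuous angle, whose
increase over a period is a multiple of `2π` and at most `2π` at a leftmost point. -/
theorem exists_tangent_angle {γ γ' : ℝ → ℂ} {L : ℝ} (hL : 0 < L)
    (hd : ∀ s, HasDerivAt γ (γ' s) s) (hc : Continuous γ') (hp : Function.Periodic γ L)
    (hi : InjOn γ (Ico 0 L)) (h0 : ∀ s, γ' s ≠ 0) :
    ∃ A : ℝ → ℝ, Continuous A ∧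
      (∀ s, γ' s = (‖γ' s‖ : ℂ) * Complex.exp (A s * Complex.I)) ∧
      (∀ s, ∃ n : ℤ, A (s + L) = A s + n * (2 * Real.pi)) ∧
      ∀ s, (∀ t, (γ s).re ≤ (γ t).re) → A (s + L) - A s ≤ 2 * Real.pi := by
  -- Clamping `q` to `[0, L]` extends the nonvanishing secant map to the whole plane, where it lifts
  -- through the exponential.
  let cl : ℝ → ℝ := fun q => max 0 (min q L)
  have hcl : Continuous cl := by fun_prop
  have hcl' : ∀ q ∈ Icc 0 L, cl q = q := fun q hq => by
    simp only [cl]; rw [min_eq_left hq.2, max_eq_right hq.1]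
  have hclm : ∀ q, cl q ∈ Icc 0 L := fun q =>
    ⟨le_max_left _ _, max_le hL.le (min_le_right _ _)⟩
  have hne : ∀ s q, q ∈ Icc 0 L → secant γ' L s q ≠ 0 := by
    intro s q hq
    rcases hq.1.eq_or_lt with rfl | h1
    · rw [secant_zero hL hd hc hp]; exact h0 s
    rcases hq.2.eq_or_lt with rfl | h2
    · rw [secant_period hL hd hc hp]; exact neg_ne_zero.2 (h0 _)
    · rw [secant_eq hd hc hp h1 h2]
      exact smul_ne_zero (by have := inv_pos.2 h1; have := inv_pos.2 (sub_pos.2 h2); positivity)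
        (sub_ne_zero.2 (ne_of_injOn_period hL hp hi h1 h2))
  let K : C(ℝ × ℝ, {z : ℂ // z ≠ 0}) :=
    ⟨fun p => ⟨secant γ' L p.1 (cl p.2), hne _ _ (hclm _)⟩,
      Continuous.subtype_mk ((continuous_secant hc L).comp
        (f := fun p : ℝ × ℝ => (p.1, cl p.2)) (by fun_prop)) _⟩
  obtain ⟨a, ⟨-, ha⟩, -⟩ := Complex.isCoveringMap_exp.existsUnique_continuousMap_lifts K (0, 0)
    (Complex.log (K (0, 0)).1) (Subtype.ext (Complex.exp_log (K (0, 0)).2))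
  have hexp : ∀ s, ∀ q ∈ Icc 0 L, Complex.exp (a (s, q)) = secant γ' L s q := by
    intro s q hq
    have := congrArg Subtype.val (congrFun ha (s, q))
    simpa [K, hcl' q hq] using this
  have hre : ∀ s, ∀ q ∈ Icc 0 L, (secant γ' L s q).re =
      Real.exp (a (s, q)).re * Real.cos (a (s, q)).im := fun s q hq => by
    rw [← hexp s q hq, Complex.exp_re]
  have h00 : (0:ℝ) ∈ Icc 0 L := ⟨le_rfl, hL.le⟩
  have hγ : ∀ s, Complex.exp (a (s, 0)) = γ' s := fun s => by
    rw [hexp s 0 h00, secant_zero hL hd hc hp]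
  have hγp : ∀ s, γ' (s + L) = γ' s := by
    intro s
    have h1 : HasDerivAt (fun x => γ (x + L)) (γ' (s + L)) s := by
      simpa [Function.comp_def] using (hd (s + L)).scomp s ((hasDerivAt_id s).add_const L)
    have : (fun x => γ (x + L)) = γ := funext hp
    rw [this] at h1
    exact h1.unique (hd s)
  refine ⟨fun s => (a (s, 0)).im, by fun_prop, ?_, ?_, ?_⟩
  · intro s
    rw [← hγ s, Complex.norm_exp, Complex.ofReal_exp, ← Complex.exp_add, Complex.re_add_im]
  · intro s
    have : Complex.exp (a (s + L, 0)) = Complex.exp (a (s, 0)) := by rw [hγ, hγ, hγp]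
    rw [Complex.exp_eq_exp_iff_exists_int] at this
    obtain ⟨n, hn⟩ := this
    exact ⟨n, by simp [hn]⟩
  · intro s hmin
    -- The angle is followed from `(s, 0)` to `(s, L)` and then to `(s + L, 0)`. On the first leg
    -- the secants leave a leftmost point and point right; on the second they arrive at it and point
    -- left. Each leg gains at most `π`.
    have h1 : ∀ q ∈ Icc 0 L, 0 ≤ (secant γ' L s q).re := by
      have hcont : ContinuousOn (fun q => (secant γ' L s q).re) (Icc 0 L) :=
        (Complex.continuous_re.comp ((continuous_secant hc L).comp
          (f := fun q : ℝ => (s, q)) (by fun_prop))).continuousOn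
      have hint : ∀ q ∈ Ioo 0 L, 0 ≤ (secant γ' L s q).re := by
        intro q hq
        rw [secant_eq hd hc hp hq.1 hq.2, Complex.smul_re, smul_eq_mul, Complex.sub_re]
        have := inv_pos.2 hq.1; have := inv_pos.2 (sub_pos.2 hq.2)
        exact mul_nonneg (by positivity) (sub_nonneg.2 (hmin _))
      rw [← closure_Ioo hL.ne] at hcont ⊢
      exact fun q hq => le_on_closure (f := fun _ => (0:ℝ)) hint continuousOn_const hcont hq
    have h2 : ∀ q ∈ Icc 0 L, (secant γ' L (s + (L - q)) q).re ≤ 0 := by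
      have hcont : ContinuousOn (fun q => (secant γ' L (s + (L - q)) q).re) (Icc 0 L) :=
        (Complex.continuous_re.comp ((continuous_secant hc L).comp
          (f := fun q : ℝ => (s + (L - q), q)) (by fun_prop))).continuousOn
      have hint : ∀ q ∈ Ioo 0 L, (secant γ' L (s + (L - q)) q).re ≤ 0 := by
        intro q hq
        rw [secant_eq hd hc hp hq.1 hq.2, Complex.smul_re, smul_eq_mul, Complex.sub_re,
          show s + (L - q) + q = s + L by ring, hp s]
        have := inv_pos.2 hq.1; have := inv_pos.2 (sub_pos.2 hq.2)
        exact mul_nonpos_of_nonneg_of_nonpos (by positivity) (sub_nonpos.2 (hmin _))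
      rw [← closure_Ioo hL.ne] at hcont ⊢
      exact fun q hq => le_on_closure (g := fun _ => (0:ℝ)) hint hcont continuousOn_const hq
    have e1 := sub_le_pi_of_cos_nonneg (b := fun q => (a (s, q)).im) (by fun_prop) (ε := 1)
      (x := 0) (y := L) one_ne_zero (fun q hq => by
        rw [uIcc_of_le hL.le] at hq
        have := h1 q hq
        rw [hre s q hq] at this
        have := nonneg_of_mul_nonneg_right this (Real.exp_pos _)
        linarith)
    have e2 := sub_le_pi_of_cos_nonneg (b := fun q => (a (s + (L - q), q)).im) (by fun_prop)
      (ε := -1) (x := L) (y := 0) (by norm_num) (fun q hq => by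
        rw [uIcc_of_ge hL.le] at hq
        have := h2 q hq
        rw [hre _ q hq] at this
        have := nonpos_of_mul_nonpos_right this (Real.exp_pos _)
        linarith)
    simp only [sub_self, sub_zero, add_zero] at e1 e2
    linarith

/-- A continuous function that increases strictly to the right of each point is strictly
increasing. -/
theorem strictMono_of_eventually_lt {A : ℝ → ℝ} (hA : Continuous A)
    (h : ∀ x, ∀ᶠ y in 𝓝[>] x, A x < A y) : StrictMono A := by
  intro x y hxy
  obtain ⟨m, hm, hmax⟩ := isCompact_Icc.exists_isMaxOn (nonempty_Icc.2 hxy.le) hA.continuousOn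
  have key : ∀ z ∈ Icc x y, (∀ w ∈ Icc x y, A w ≤ A z) → z = y := by
    intro z hz hzm
    by_contra hne
    have hlt : z < y := lt_of_le_of_ne hz.2 hne
    obtain ⟨w, hw1, hw2⟩ := ((h z).and (Ioo_mem_nhdsGT hlt)).exists
    exact absurd (hzm w ⟨hz.1.trans hw2.1.le, hw2.2.le⟩) (not_le.2 hw1)
  have hmy := key m hm hmax
  subst hmy
  refine lt_of_le_of_ne (hmax (left_mem_Icc.2 hxy.le)) fun heq => ?_
  exact hxy.ne (key x (left_mem_Icc.2 hxy.le) fun w hw => by rw [heq]; exact hmax hw)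

/-! ### The tangent angle and convexity of a positively curved loop -/

section Loop

variable {X : Type*} [NormedAddCommGroup X] [NormedSpace ℝ X]

/-- A simple closed curve `γ` of period `L` whose velocity is `ς s • φ' (θ s)`, of unit speed in
the anti-norm, and whose circular curvature `k` is positive. -/
structure IsPositiveLoop (e : X ≃L[ℝ] ℝ × ℝ) (φ φ' γ : ℝ → X) (θ ς k : ℝ → ℝ) (L : ℝ) : Prop where
  circle : IsOrientedCircle e φ φ'
  hasDerivAt : ∀ s, HasDerivAt γ (ς s • φ' (θ s)) s
  hasDerivAt_angle : ∀ s, HasDerivAt θ (k s * ς s) s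
  continuous_speed : Continuous ς
  continuous_curvature : Continuous k
  speed_pos : ∀ s, 0 < ς s
  curvature_pos : ∀ s, 0 < k s
  antinorm_speed : ∀ s, ς s * crossForm e (φ' (θ s)) (φ (θ s)) = 1
  length_pos : 0 < L
  periodic : Function.Periodic γ L
  injOn : InjOn γ (Ico 0 L)

namespace IsPositiveLoop

variable {e : X ≃L[ℝ] ℝ × ℝ} {φ φ' γ : ℝ → X} {θ ς k : ℝ → ℝ} {L : ℝ}

theorem continuous (h : IsPositiveLoop e φ φ' γ θ ς k L) : Continuous γ :=
  continuous_iff_continuousAt.2 fun t => (h.hasDerivAt t).continuousAt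

theorem isCompact_range (h : IsPositiveLoop e φ φ' γ θ ς k L) : IsCompact (range γ) := by
  have : range γ = γ '' Icc 0 L := by
    refine subset_antisymm ?_ (image_subset_range _ _)
    rintro _ ⟨t, rfl⟩
    obtain ⟨t', ht', htt⟩ := h.periodic.exists_mem_Ico₀ h.length_pos t
    exact ⟨t', Ico_subset_Icc_self ht', htt.symm⟩
  rw [this]
  exact isCompact_Icc.image h.continuous

theorem continuous_angle (h : IsPositiveLoop e φ φ' γ θ ς k L) : Continuous θ :=
  continuous_iff_continuousAt.2 fun t => (h.hasDerivAt_angle t).continuousAt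

theorem strictMono_angle (h : IsPositiveLoop e φ φ' γ θ ς k L) : StrictMono θ :=
  strictMono_of_deriv_pos fun s => by
    rw [(h.hasDerivAt_angle s).deriv]
    exact mul_pos (h.curvature_pos s) (h.speed_pos s)

theorem hasDerivAt_crossForm (h : IsPositiveLoop e φ φ' γ θ ς k L) (y p : X) (s : ℝ) :
    HasDerivAt (fun t => crossForm e y (γ t - p)) (ς s * crossForm e y (φ' (θ s))) s := by
  simpa [Function.comp_def] using (crossForm e y).hasFDerivAt.comp_hasDerivAt s ((h.hasDerivAt s).sub_const p)

theorem velocity_periodic (h : IsPositiveLoop e φ φ' γ θ ς k L) (s : ℝ) :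
    ς (s + L) • φ' (θ (s + L)) = ς s • φ' (θ s) := by
  have h1 : HasDerivAt (fun x => γ (x + L)) (ς (s + L) • φ' (θ (s + L))) s := by
    simpa [Function.comp_def] using
      (h.hasDerivAt (s + L)).scomp s ((hasDerivAt_id s).add_const L)
  rw [show (fun x => γ (x + L)) = γ from funext h.periodic] at h1
  exact h1.unique (h.hasDerivAt s)

theorem crossForm_of_angle {A r : ℝ → ℝ}
    (hA : ∀ s, e (φ' (θ s)) = (r s * Real.cos (A s), r s * Real.sin (A s))) (s v : ℝ) :
    crossForm e (φ' (θ s)) (φ' (θ v)) = r s * r v * Real.sin (A s - A v) := by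
  rw [crossForm_apply, hA, hA, cross, Real.sin_sub]
  ring

/-- The tangent angle of a simple closed curve of positive curvature increases strictly, by `2π`
over each period. -/
theorem exists_angle [StrictConvexSpace ℝ X] (h : IsPositiveLoop e φ φ' γ θ ς k L) :
    ∃ A r : ℝ → ℝ, Continuous A ∧ StrictMono A ∧ (∀ s, A (s + L) = A s + 2 * Real.pi) ∧
      (∀ s, 0 < r s) ∧
      ∀ s, e (φ' (θ s)) = (r s * Real.cos (A s), r s * Real.sin (A s)) := by
  let E : X ≃L[ℝ] ℂ := e.trans Complex.equivRealProdCLM.symm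
  have hEre : ∀ x, (E x).re = (e x).1 := fun x => by
    simp [E, Complex.equivRealProdCLM_symm_apply]
  have hEim : ∀ x, (E x).im = (e x).2 := fun x => by
    simp [E, Complex.equivRealProdCLM_symm_apply]
  have hv0 : ∀ s, ς s • φ' (θ s) ≠ 0 := fun s =>
    smul_ne_zero (h.speed_pos s).ne' (h.circle.deriv_ne_zero _)
  have hi : InjOn (fun s => E (γ s)) (Ico 0 L) := fun a ha b hb hab =>
    h.injOn ha hb (E.injective hab)
  have hp : Function.Periodic (fun s => E (γ s)) L := fun s => by simp only [h.periodic s]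
  obtain ⟨A, hAc, hA, hAn, hAm⟩ := exists_tangent_angle (γ := fun s => E (γ s))
    (γ' := fun s => E (ς s • φ' (θ s))) h.length_pos
    (fun s => (E : X →L[ℝ] ℂ).hasFDerivAt.comp_hasDerivAt s (h.hasDerivAt s))
    (E.continuous.comp (h.continuous_speed.smul
      (h.circle.continuous_deriv.comp h.continuous_angle)))
    hp hi (fun s => by simpa using hv0 s)
  have hr : ∀ s, 0 < ‖E (φ' (θ s))‖ := fun s => by
    have := h.circle.deriv_ne_zero (θ s)
    simpa using this
  have hform : ∀ s, e (φ' (θ s)) =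
      (‖E (φ' (θ s))‖ * Real.cos (A s), ‖E (φ' (θ s))‖ * Real.sin (A s)) := by
    intro s
    have h1 := hA s
    simp only [map_smul, norm_smul, Real.norm_eq_abs, abs_of_pos (h.speed_pos s)] at h1
    have h2 : E (φ' (θ s)) = (‖E (φ' (θ s))‖ : ℂ) * Complex.exp (A s * Complex.I) := by
      have hne : ((ς s : ℝ) : ℂ) ≠ 0 := by exact_mod_cast (h.speed_pos s).ne'
      apply mul_left_cancel₀ hne
      rw [← Complex.real_smul, h1]
      push_cast
      ring
    ext
    · rw [← hEre, h2, Complex.re_ofReal_mul, Complex.exp_ofReal_mul_I_re]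
      simp
    · rw [← hEim, h2, Complex.im_ofReal_mul, Complex.exp_ofReal_mul_I_im]
      simp
  have hmono : StrictMono A := by
    refine strictMono_of_eventually_lt hAc fun s => ?_
    have ht : Tendsto θ (𝓝[>] s) (𝓝[>] (θ s)) :=
      tendsto_nhdsWithin_iff.2 ⟨h.continuous_angle.continuousAt.mono_left nhdsWithin_le_nhds,
        eventually_nhdsWithin_of_forall fun v hv => h.strictMono_angle hv⟩
    have hnear : ∀ᶠ v in 𝓝[>] s, |A s - A v| < Real.pi := by
      apply eventually_nhdsWithin_of_eventually_nhds
      have hcont : Continuous fun v => |A s - A v| := by fun_prop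
      exact hcont.continuousAt.eventually (gt_mem_nhds (by simpa using Real.pi_pos))
    -- Just after `s` the tangent has turned left, so the sine of a difference smaller than `π` has
    -- a definite sign.
    filter_upwards [ht.eventually (h.circle.crossForm_deriv_neg_right (θ s)), hnear] with v hv hn
    rw [crossForm_of_angle hform] at hv
    by_contra! hle
    have := Real.sin_nonneg_of_nonneg_of_le_pi (sub_nonneg.2 hle) ((le_abs_self _).trans hn.le)
    have := mul_nonneg (mul_pos (hr s) (hr v)).le this
    linarith
  refine ⟨A, fun s => ‖E (φ' (θ s))‖, hAc, hmono, ?_, hr, hform⟩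
  have hpi := Real.pi_pos
  intro s
  -- `m` is a leftmost parameter with `m ≤ s ≤ m + L`. Two periods from `m` gain at most `4π` and
  -- contain `[s, s + L]`, so monotonicity leaves only the multiple `1` of `2π`.
  obtain ⟨m, hm, hmin⟩ := isCompact_Icc.exists_isMinOn
    (nonempty_Icc.2 (sub_le_self s h.length_pos.le))
    (Complex.continuous_re.comp (E.continuous.comp h.continuous)).continuousOn
  have hglob : ∀ t, (E (γ m)).re ≤ (E (γ t)).re := by
    intro t
    obtain ⟨t', ht', htt⟩ := h.periodic.exists_mem_Ico h.length_pos t (s - L)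
    rw [htt]
    exact hmin ⟨ht'.1, by linarith [ht'.2]⟩
  have hm1 := hAm m hglob
  have hm2 := hAm (m + L) (fun t => by simp only [h.periodic m]; exact hglob t)
  obtain ⟨n, hn⟩ := hAn s
  have hlow : 0 < (n : ℝ) := by
    have := hmono (show s < s + L by linarith [h.length_pos])
    rw [hn] at this
    by_contra hc
    push Not at hc
    nlinarith
  have hup : (n : ℝ) < 2 := by
    have h1 : A m ≤ A s := hmono.monotone hm.2
    have h2 : A (s + L) ≤ A (m + L + L) := hmono.monotone (by linarith [hm.1])
    have hlt : A (s + L) - A s < 4 * Real.pi := by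
      rcases hm.2.eq_or_lt with rfl | hlt
      · linarith
      · have := hmono hlt
        linarith
    rw [hn] at hlt
    nlinarith
  have hn1 : n = 1 := by
    have : 0 < n := by exact_mod_cast hlow
    have : n < 2 := by exact_mod_cast hup
    omega
  rw [hn, hn1]
  simp

/-- A short arc along which the tangent turns by less than `π`. -/
theorem exists_turning_arc [StrictConvexSpace ℝ X] (h : IsPositiveLoop e φ φ' γ θ ς k L) (s : ℝ) :
    ∃ b > s, ∀ v w, s ≤ v → v < w → w < b → 0 < crossForm e (φ' (θ w)) (φ' (θ v)) := by
  obtain ⟨A, r, hc, hm, hp, hr, hf⟩ := h.exists_angle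
  have hpi := Real.pi_pos
  have hev : ∀ᶠ b in 𝓝[>] s, A b < A s + Real.pi := by
    apply eventually_nhdsWithin_of_eventually_nhds
    exact hc.continuousAt.eventually (gt_mem_nhds (by linarith))
  obtain ⟨b, hb, hsb⟩ := (hev.and self_mem_nhdsWithin).exists
  refine ⟨b, hsb, fun v w hv hvw hw => ?_⟩
  rw [crossForm_of_angle hf]
  have h1 := hm.monotone hv
  have h2 := hm hvw
  have h3 := hm hw
  exact mul_pos (mul_pos (hr _) (hr _)) (Real.sin_pos_of_pos_of_lt_pi (by linarith) (by linarith))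

/-- A simple closed curve of positive curvature lies on one side of each of its tangent lines. -/
theorem crossForm_sub_nonpos [StrictConvexSpace ℝ X] (h : IsPositiveLoop e φ φ' γ θ ς k L)
    (s t : ℝ) : crossForm e (φ' (θ s)) (γ t - γ s) ≤ 0 := by
  obtain ⟨A, r, hc, hm, hp, hr, hf⟩ := h.exists_angle
  have hpi := Real.pi_pos
  have hL := h.length_pos
  have hcont : Continuous fun t => crossForm e (φ' (θ s)) (γ t - γ s) :=
    continuous_crossForm e (h.continuous.sub continuous_const) continuous_const
  -- At `b` the tangent has turned by `π`. The height over the tangent line at `s` decreases up to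
  -- `b`, then increases, and it is zero at both `s` and `s + L`.
  obtain ⟨b, hb, hAb⟩ : ∃ b ∈ Icc s (s + L), A b = A s + Real.pi :=
    intermediate_value_Icc (by linarith) hc.continuousOn
      ⟨by linarith, by linarith [hp s]⟩
  obtain ⟨t', ht', htt⟩ := h.periodic.exists_mem_Ico hL t s
  rw [htt]
  rcases le_total t' b with htb | htb
  · have hanti : AntitoneOn (fun t => crossForm e (φ' (θ s)) (γ t - γ s)) (Icc s b) := by
      refine antitoneOn_of_deriv_nonpos (convex_Icc _ _) hcont.continuousOn
        (fun x _ => (h.hasDerivAt_crossForm _ _ x).differentiableAt.differentiableWithinAt)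
        fun x hx => ?_
      rw [interior_Icc] at hx
      rw [(h.hasDerivAt_crossForm _ _ x).deriv, crossForm_of_angle hf]
      have h1 := hm hx.1
      have h2 := hm hx.2
      refine mul_nonpos_of_nonneg_of_nonpos (h.speed_pos x).le
        (mul_nonpos_of_nonneg_of_nonpos (mul_pos (hr _) (hr _)).le
          (Real.sin_nonpos_of_nonpos_of_neg_pi_le (by linarith) (by linarith)))
    have := hanti (left_mem_Icc.2 hb.1) ⟨ht'.1, htb⟩ ht'.1
    simpa using this
  · have hmon : MonotoneOn (fun t => crossForm e (φ' (θ s)) (γ t - γ s)) (Icc b (s + L)) := by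
      refine monotoneOn_of_deriv_nonneg (convex_Icc _ _) hcont.continuousOn
        (fun x _ => (h.hasDerivAt_crossForm _ _ x).differentiableAt.differentiableWithinAt)
        fun x hx => ?_
      rw [interior_Icc] at hx
      rw [(h.hasDerivAt_crossForm _ _ x).deriv, crossForm_of_angle hf]
      have h1 := hm hx.1
      have h2 := hm hx.2
      have h3 := hp s
      refine mul_nonneg (h.speed_pos x).le (mul_nonneg (mul_pos (hr _) (hr _)).le ?_)
      rw [← Real.sin_add_two_pi]
      exact Real.sin_nonneg_of_nonneg_of_le_pi (by linarith) (by linarith)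
    have := hmon ⟨htb, ht'.2.le⟩ (right_mem_Icc.2 hb.2) ht'.2.le
    simpa [h.periodic s] using this

/-- The tangent of a positively curved loop takes every direction. -/
theorem exists_angle_eq [StrictConvexSpace ℝ X] (h : IsPositiveLoop e φ φ' γ θ ς k L) (τ : ℝ) :
    ∃ s, φ (θ s) = φ τ := by
  obtain ⟨A, r, hc, hm, hp, hr, hf⟩ := h.exists_angle
  set z : ℂ := Complex.equivRealProdCLM.symm (e (φ' τ)) with hz
  have hz0 : z ≠ 0 := by simpa [hz] using h.circle.deriv_ne_zero τ
  have hmem := toIcoMod_mem_Ico Real.two_pi_pos (A 0) z.arg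
  have hAL := hp 0
  rw [zero_add] at hAL
  obtain ⟨s, -, hs⟩ := intermediate_value_Icc h.length_pos.le hc.continuousOn
    (show toIcoMod Real.two_pi_pos (A 0) z.arg ∈ Icc (A 0) (A L) from
      ⟨hmem.1, by rw [hAL]; exact hmem.2.le⟩)
  have hcos : Real.cos (A s) = Real.cos z.arg := by
    rw [hs, toIcoMod, Real.cos_periodic.sub_zsmul_eq]
  have hsin : Real.sin (A s) = Real.sin z.arg := by
    rw [hs, toIcoMod, Real.sin_periodic.sub_zsmul_eq]
  have hnz : 0 < ‖z‖ := norm_pos_iff.2 hz0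
  have hre : (e (φ' τ)).1 = z.re := by simp [hz, Complex.equivRealProdCLM_symm_apply]
  have him : (e (φ' τ)).2 = z.im := by simp [hz, Complex.equivRealProdCLM_symm_apply]
  refine ⟨s, h.circle.eq_of_deriv_eq_smul (a := r s / ‖z‖) (div_pos (hr s) hnz) ?_⟩
  apply e.injective
  rw [hf, map_smul, hcos, hsin, Complex.cos_arg hz0, Complex.sin_arg]
  ext
  · simp [hre]; field_simp
  · simp [him]; field_simp

end IsPositiveLoop

end Loop

/-! ### The enclosed region and half-planes -/

section Region

variable {X : Type*} [NormedAddCommGroup X]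

theorem mem_enclosedRegion_of_isPreconnected {Γ C : Set X} {x y : X} (hC : IsPreconnected C)
    (hCΓ : C ⊆ Γᶜ) (hx : x ∈ C) (hy : y ∈ C) (h : x ∈ enclosedRegion Γ) :
    y ∈ enclosedRegion Γ := by
  refine ⟨hCΓ hy, ?_⟩
  rw [← connectedComponentIn_eq (hC.subset_connectedComponentIn hx hCΓ hy)]
  exact h.2

/-- A connected set avoiding the sphere stays in the ball or in its exterior. Only this inclusion is
needed, since the upper area bound holds for any loop. -/
theorem ball_subset_enclosedRegion_sphere (p : X) (r : ℝ) :
    Metric.ball p r ⊆ enclosedRegion (Metric.sphere p r) := by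
  intro x hx
  refine ⟨fun h => (Metric.mem_ball.1 hx).ne (Metric.mem_sphere.1 h), ?_⟩
  refine (Metric.isBounded_ball (x := p) (r := r)).subset ?_
  have hx' : x ∈ (Metric.sphere p r)ᶜ := fun h =>
    (Metric.mem_ball.1 hx).ne (Metric.mem_sphere.1 h)
  refine isPreconnected_connectedComponentIn.subset_left_of_subset_union
    (v := (Metric.closedBall p r)ᶜ) Metric.isOpen_ball Metric.isClosed_closedBall.isOpen_compl
    (disjoint_compl_right.mono_left Metric.ball_subset_closedBall) ?_
    ⟨x, mem_connectedComponentIn hx', hx⟩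
  intro y hy
  have hne : dist y p ≠ r := connectedComponentIn_subset _ _ hy
  rcases hne.lt_or_gt with h | h
  · exact Or.inl h
  · exact Or.inr (by simpa using h)

variable [NormedSpace ℝ X]

/-- The enclosed region lies in each half-plane `{f ≤ c}` that contains the curve. -/
theorem apply_le_of_mem_enclosedRegion {Γ : Set X} (f : X →L[ℝ] ℝ) {c : ℝ} {v : X} (hv : 0 < f v)
    (hΓ : ∀ y ∈ Γ, f y ≤ c) {x : X} (hx : x ∈ enclosedRegion Γ) : f x ≤ c := by
  by_contra! hlt
  -- The opposite open half-plane misses the curve and is connected, so the bounded component of `x`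
  -- would contain it.
  have hsub : {y | c < f y} ⊆ connectedComponentIn Γᶜ x :=
    (convex_halfSpace_gt f.isLinear c).isPreconnected.subset_connectedComponentIn hlt
      fun y hy hyΓ => not_lt.2 (hΓ y hyΓ) hy
  obtain ⟨R, hR⟩ := (hx.2.subset hsub).exists_norm_le
  have hv0 : 0 < ‖v‖ := norm_pos_iff.2 fun h0 => by simp [h0] at hv
  have hxR := hR x hlt
  have hR0 : 0 ≤ R := (norm_nonneg x).trans hxR
  -- A translation of length `2R + 1` takes `x` out of the ball of radius `R`.
  set a := (2 * R + 1) / ‖v‖ with ha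
  have ha0 : 0 < a := by positivity
  have hmem : x + a • v ∈ {y | c < f y} := by
    simp only [mem_ofPred_eq, map_add, map_smul, smul_eq_mul]
    have := mul_pos ha0 hv
    linarith
  have h1 := hR _ hmem
  have h2 : ‖a • v‖ = 2 * R + 1 := by
    rw [norm_smul, Real.norm_eq_abs, abs_of_pos ha0, ha, div_mul_cancel₀ _ hv0.ne']
  have h3 := norm_sub_le (x + a • v) x
  rw [add_sub_cancel_left, h2] at h3
  linarith

theorem ball_subset_enclosedRegion {Γ : Set X} {x : X} {r : ℝ} (hr : 0 < r)
    (h : Metric.ball x r ⊆ Γᶜ) (hx : x ∈ enclosedRegion Γ) :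
    Metric.ball x r ⊆ enclosedRegion Γ := fun _ hy =>
  mem_enclosedRegion_of_isPreconnected (convex_ball x r).isPreconnected h
    (Metric.mem_ball_self hr) hy hx

end Region

/-! ### Nearest points and bounds on the distance to the curve -/

namespace IsPositiveLoop

variable {X : Type*} [NormedAddCommGroup X] [NormedSpace ℝ X] [StrictConvexSpace ℝ X]
  {e : X ≃L[ℝ] ℝ × ℝ} {φ φ' γ : ℝ → X} {θ ς k : ℝ → ℝ} {L : ℝ}

theorem crossForm_sub_nonpos_of_mem (h : IsPositiveLoop e φ φ' γ θ ς k L) {x : X}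
    (hx : x ∈ enclosedRegion (range γ)) (s : ℝ) : crossForm e (φ' (θ s)) (x - γ s) ≤ 0 := by
  have := apply_le_of_mem_enclosedRegion (crossForm e (φ' (θ s)))
    (c := crossForm e (φ' (θ s)) (γ s)) (h.circle.pos (θ s)) (by
      rintro _ ⟨t, rfl⟩
      simpa using h.crossForm_sub_nonpos s t) hx
  simpa using this

/-- A point of the enclosed region lies on the inner normal at a nearest point of the curve, and
its distance to the curve is at most its distance to any tangent line. -/
theorem exists_foot (h : IsPositiveLoop e φ φ' γ θ ς k L) {x : X}
    (hx : x ∈ enclosedRegion (range γ)) :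
    ∃ s ∈ Ico 0 L, ∃ r : ℝ, 0 ≤ r ∧ γ s - x = r • φ (θ s) ∧
      ∀ t, r * crossForm e (φ' (θ t)) (φ (θ t)) ≤ crossForm e (φ' (θ t)) (γ t - x) := by
  obtain ⟨_, ⟨s₀, rfl⟩, hs₀⟩ := h.isCompact_range.exists_infDist_eq_dist (range_nonempty γ) x
  obtain ⟨s, hs, hss⟩ := h.periodic.exists_mem_Ico₀ h.length_pos s₀
  rw [hss] at hs₀
  set r := Metric.infDist x (range γ) with hr
  have hnorm : ‖γ s - x‖ = r := by rw [hs₀, dist_eq_norm, norm_sub_rev]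
  have hr0 : 0 < r := by
    rw [← hnorm, norm_pos_iff, sub_ne_zero]
    rintro rfl
    exact hx.1 (mem_range_self s)
  have hball : Metric.ball x r ⊆ enclosedRegion (range γ) := by
    refine ball_subset_enclosedRegion hr0 (fun y hy hyΓ => ?_) hx
    have := Metric.infDist_le_dist_of_mem (x := x) hyΓ
    rw [dist_comm] at this
    exact absurd (Metric.mem_ball.1 hy) (not_lt.2 this)
  have hdist : ∀ t, r * crossForm e (φ' (θ t)) (φ (θ t)) ≤
      crossForm e (φ' (θ t)) (γ t - x) := by
    intro t
    -- The disk of radius `r` about `x` lies in every tangent half-plane. Its points in direction `φ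
    -- (θ t)` give the bound as `q → r`.
    refine le_of_tendsto (f := fun q : ℝ => q * crossForm e (φ' (θ t)) (φ (θ t)))
      (x := 𝓝[<] r) ((by fun_prop : Continuous fun q : ℝ =>
        q * crossForm e (φ' (θ t)) (φ (θ t))).continuousAt.mono_left nhdsWithin_le_nhds) ?_
    filter_upwards [Ioo_mem_nhdsLT hr0] with q hq
    have hmem : x + q • φ (θ t) ∈ Metric.ball x r := by
      rw [Metric.mem_ball, dist_eq_norm, add_sub_cancel_left, norm_smul, h.circle.norm_eq,
        Real.norm_eq_abs, abs_of_pos hq.1, mul_one]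
      exact hq.2
    have := h.crossForm_sub_nonpos_of_mem (hball hmem) t
    simp only [map_sub, map_add, map_smul, smul_eq_mul] at this ⊢
    linarith
  refine ⟨s, hs, r, hr0.le, ?_, hdist⟩
  -- At the nearest point the support inequality is an equality, which fixes the direction.
  have := h.circle.eq_of_le_crossForm (u := θ s) (x := γ s - x) (by
    rw [hnorm, mul_comm]
    exact hdist s)
  rwa [hnorm] at this

/-- No focal point of the inner normal at `s` comes before the center of an enclosed disk
touching the curve at `γ s`. -/
theorem mul_curvature_le_one (h : IsPositiveLoop e φ φ' γ θ ς k L) {x : X} {s r : ℝ}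
    (hs : γ s - x = r • φ (θ s))
    (hr : ∀ t, r * crossForm e (φ' (θ t)) (φ (θ t)) ≤ crossForm e (φ' (θ t)) (γ t - x)) :
    r * k s ≤ 1 := by
  by_contra! hlt
  obtain ⟨b, hb, hpos⟩ := h.exists_turning_arc s
  have hev : ∀ᶠ v in 𝓝 s, 1 < r * k v :=
    (continuous_const.mul h.continuous_curvature).continuousAt.eventually (lt_mem_nhds hlt)
  obtain ⟨δ, hδ, hk⟩ := Metric.eventually_nhds_iff.1 hev
  set t := min ((s + b) / 2) (s + δ / 2) with ht
  have hst : s < t := lt_min (by linarith) (by linarith)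
  have htb : t < b := (min_le_left _ _).trans_lt (by linarith)
  have htδ : t < s + δ := (min_le_right _ _).trans_lt (by linarith)
  set f := crossForm e (φ' (θ t)) with hf
  -- The inner parallel curve at distance `r` moves backwards where `r k > 1`. Starting from `x`, it
  -- ends on the wrong side of the line at distance `r` inside the tangent at `t`.
  have hd : ∀ v, HasDerivAt (fun v => f (γ v - x - r • φ (θ v)))
      (ς v * (1 - r * k v) * f (φ' (θ v))) v := by
    intro v
    have h1 := ((h.hasDerivAt v).sub_const x).sub
      (((h.circle.hasDerivAt (θ v)).scomp v (h.hasDerivAt_angle v)).const_smul r)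
    have h2 := f.hasFDerivAt.comp_hasDerivAt v h1
    refine h2.congr_deriv ?_
    simp only [map_sub, map_smul, smul_eq_mul]
    ring
  have hanti : StrictAntiOn (fun v => f (γ v - x - r • φ (θ v))) (Icc s t) := by
    refine strictAntiOn_of_deriv_neg (convex_Icc _ _)
      (fun v _ => (hd v).continuousAt.continuousWithinAt) fun v hv => ?_
    rw [interior_Icc] at hv
    rw [(hd v).deriv]
    have h1 := hpos v t hv.1.le hv.2 htb
    have h2 : 1 < r * k v := hk (by
      rw [Real.dist_eq, abs_lt]; constructor <;> linarith [hv.1, hv.2])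
    have h3 := h.speed_pos v
    exact mul_neg_of_neg_of_pos (mul_neg_of_pos_of_neg h3 (by linarith)) h1
  have := hanti (left_mem_Icc.2 hst.le) (right_mem_Icc.2 hst.le) hst
  simp only [hs, sub_self, map_zero, map_sub, map_smul, smul_eq_mul] at this
  have h4 := hr t
  rw [map_sub] at h4
  linarith

/-- The parameter `θ` is strictly increasing, hence not periodic; only the point of the unit circle
returns, because the velocity does. -/
theorem angle_periodic (h : IsPositiveLoop e φ φ' γ θ ς k L) (s : ℝ) :
    φ (θ (s + L)) = φ (θ s) := by
  refine h.circle.eq_of_deriv_eq_smul (a := (ς (s + L))⁻¹ * ς s)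
    (mul_pos (inv_pos.2 (h.speed_pos _)) (h.speed_pos _)) ?_
  rw [mul_smul, ← h.velocity_periodic s, inv_smul_smul₀ (h.speed_pos _).ne']

/-- The radius of an enclosed disk is at most the length divided by the total curvature. -/
theorem mul_integral_curvature_le (h : IsPositiveLoop e φ φ' γ θ ς k L) {x : X} {r : ℝ}
    (hr : ∀ t, r * crossForm e (φ' (θ t)) (φ (θ t)) ≤ crossForm e (φ' (θ t)) (γ t - x)) :
    r * ∫ s in (0:ℝ)..L, k s ≤ L := by
  -- The term `-1` is the anti-norm normalization; the other term is the curvature times the norm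
  -- distance from `x` to the tangent line, which is at least `r`.
  have hd : ∀ s, HasDerivAt (fun s => crossForm e (φ (θ s)) (γ s - x))
      (-1 + k s * ς s * crossForm e (φ' (θ s)) (γ s - x)) s := by
    intro s
    have hγ := (h.hasDerivAt s).sub_const x
    have hφ := (h.circle.hasDerivAt (θ s)).scomp s (h.hasDerivAt_angle s)
    let E₁ : X →L[ℝ] ℝ := (ContinuousLinearMap.fst ℝ ℝ ℝ).comp (e : X →L[ℝ] ℝ × ℝ)
    let E₂ : X →L[ℝ] ℝ := (ContinuousLinearMap.snd ℝ ℝ ℝ).comp (e : X →L[ℝ] ℝ × ℝ)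
    have h3 := ((E₁.hasFDerivAt.comp_hasDerivAt s hγ).mul (E₂.hasFDerivAt.comp_hasDerivAt s hφ)).sub
      ((E₂.hasFDerivAt.comp_hasDerivAt s hγ).mul (E₁.hasFDerivAt.comp_hasDerivAt s hφ))
    have h4 := h.antinorm_speed s
    simp only [crossForm_apply, cross] at h4 ⊢
    refine h3.congr_deriv ?_
    simp only [E₁, E₂, ContinuousLinearMap.comp_apply, ContinuousLinearMap.coe_fst',
      ContinuousLinearMap.coe_snd', ContinuousLinearEquiv.coe_coe, map_smul, map_sub, 
      Prod.fst_sub, Prod.snd_sub, smul_eq_mul, Function.comp_apply]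
    rw [← h4]
    ring
  have hI : ∀ s, HasDerivAt (fun s => ∫ u in (0:ℝ)..s, k u) (k s) s := fun s =>
    intervalIntegral.integral_hasDerivAt_right (h.continuous_curvature.intervalIntegrable _ _)
      (h.continuous_curvature.stronglyMeasurableAtFilter _ _) h.continuous_curvature.continuousAt
  have hU : ∀ s, HasDerivAt (fun s => crossForm e (φ (θ s)) (γ s - x) + s -
      r * ∫ u in (0:ℝ)..s, k u)
      (-1 + k s * ς s * crossForm e (φ' (θ s)) (γ s - x) + 1 - r * k s) s := fun s =>
    ((hd s).add (hasDerivAt_id s)).sub ((hI s).const_mul r)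
  -- The first summand is periodic, so the increase over one period is `L - r ∫ k`.
  have hm := monotone_of_hasDerivAt_nonneg hU fun s => by
    have h1 := mul_le_mul_of_nonneg_left (hr s)
      (mul_pos (h.curvature_pos s) (h.speed_pos s)).le
    have h2 := h.antinorm_speed s
    have h3 : k s * ς s * (r * crossForm e (φ' (θ s)) (φ (θ s))) = r * k s := by
      linear_combination r * k s * h2
    rw [h3] at h1
    simp only [Pi.zero_apply]
    linarith
  have := hm h.length_pos.le
  have hp := h.periodic 0
  have hq := h.angle_periodic 0
  rw [zero_add] at hp hq
  simp only [hp, hq, intervalIntegral.integral_same, mul_zero] at this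
  linarith

end IsPositiveLoop

/-! ### The induced area as Lebesgue measure -/

section Area

variable {X : Type*} [NormedAddCommGroup X] [NormedSpace ℝ X]

theorem parallelepiped_finTwoProd :
    parallelepiped (Module.Basis.finTwoProd ℝ) = Icc (0:ℝ) 1 ×ˢ Icc (0:ℝ) 1 := by
  rw [parallelepiped_basis_eq]
  ext p
  simp [Fin.forall_fin_two, Prod.le_def]
  tauto

theorem volume_eq_addHaar_finTwoProd :
    (volume : Measure (ℝ × ℝ)) = (Module.Basis.finTwoProd ℝ).addHaar := by
  refine ((Module.Basis.addHaar_eq_iff _ _).2 ?_).symm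
  rw [Module.Basis.coe_parallelepiped, parallelepiped_finTwoProd, Measure.volume_eq_prod,
    Measure.prod_prod]
  simp

/-- In linear coordinates where the area form is standard up to sign, the induced area measure is
Lebesgue measure. -/
theorem alternatingMap_measure_eq_volume_image [FiniteDimensional ℝ X]
    [Fact (Module.finrank ℝ X = 2)] [MeasurableSpace X] [BorelSpace X]
    (Ω : X [⋀^Fin 2]→ₗ[ℝ] ℝ) (e : X ≃L[ℝ] ℝ × ℝ)
    (h : ∀ x y, |Ω ![x, y]| = |cross (e x) (e y)|) (A : Set X) :
    Ω.measure A = volume (e '' A) := by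
  have h1 : ((Module.Basis.finTwoProd ℝ).map e.symm.toLinearEquiv).addHaar = Ω.measure := by
    rw [Module.Basis.addHaar_eq_iff, Module.Basis.coe_parallelepiped,
      AlternatingMap.measure_parallelepiped]
    have : (⇑((Module.Basis.finTwoProd ℝ).map e.symm.toLinearEquiv) : Fin 2 → X) =
        ![e.symm (1, 0), e.symm (0, 1)] := by
      ext i
      fin_cases i <;> simp
    rw [this, h]
    simp [cross]
  rw [← h1, ← Module.Basis.map_addHaar, ← volume_eq_addHaar_finTwoProd,
    show (⇑e.symm : ℝ × ℝ → X) = e.symm.toHomeomorph.toMeasurableEquiv from rfl,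
    MeasurableEquiv.map_apply]
  congr 1
  exact (e.toEquiv.image_eq_preimage_symm A).symm

end Area

/-! ### Area swept out by inner normals -/

/-- Fubini for the region under a graph. -/
theorem setLIntegral_subgraph {m : ℝ → ℝ} (hm : Measurable m) {g : ℝ × ℝ → ENNReal}
    (hg : Measurable g) (S : Set ℝ) (hS : MeasurableSet S) :
    ∫⁻ p in {p : ℝ × ℝ | p.1 ∈ S ∧ p.2 ∈ Icc 0 (m p.1)}, g p =
      ∫⁻ s in S, ∫⁻ q in Icc 0 (m s), g (s, q) := by
  have hmeas : MeasurableSet {p : ℝ × ℝ | p.1 ∈ S ∧ p.2 ∈ Icc 0 (m p.1)} :=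
    (measurable_fst hS).inter ((measurableSet_le measurable_const measurable_snd).inter
      (measurableSet_le measurable_snd (hm.comp measurable_fst)))
  rw [← lintegral_indicator hmeas, Measure.volume_eq_prod,
    lintegral_prod _ (hg.indicator hmeas).aemeasurable, ← lintegral_indicator hS]
  congr 1 with s
  by_cases hs : s ∈ S
  · rw [indicator_of_mem hs, ← lintegral_indicator measurableSet_Icc]
    congr 1 with q
    simp [indicator, hs]
  · simp [indicator, hs]

theorem setLIntegral_abs_one_sub_mul {k m : ℝ} (hk : 0 ≤ k) (hm : 0 ≤ m) (hmk : m * k ≤ 1) :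
    ∫⁻ q in Icc 0 m, ENNReal.ofReal |1 - q * k| = ENNReal.ofReal (m - m ^ 2 * k / 2) := by
  have h1 : ∫⁻ q in Icc 0 m, ENNReal.ofReal |1 - q * k| =
      ∫⁻ q in Icc 0 m, ENNReal.ofReal (1 - q * k) := by
    refine setLIntegral_congr_fun measurableSet_Icc fun q hq => ?_
    have := mul_le_mul_of_nonneg_right hq.2 hk
    rw [abs_of_nonneg (by linarith)]
  have hc : Continuous fun q : ℝ => 1 - q * k := by fun_prop
  rw [h1, ← ofReal_integral_eq_lintegral_ofReal hc.continuousOn.integrableOn_Icc]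
  · congr 1
    rw [integral_Icc_eq_integral_Ioc, ← intervalIntegral.integral_of_le hm,
      intervalIntegral.integral_sub (by simp) (Continuous.intervalIntegrable (by fun_prop) _ _),
      intervalIntegral.integral_mul_const]
    simp
    ring
  · filter_upwards [ae_restrict_mem measurableSet_Icc] with q hq
    have := mul_le_mul_of_nonneg_right hq.2 hk
    simp only [Pi.zero_apply]
    linarith

namespace IsPositiveLoop

variable {X : Type*} [NormedAddCommGroup X] [NormedSpace ℝ X]
  {e : X ≃L[ℝ] ℝ × ℝ} {φ φ' γ : ℝ → X} {θ ς k : ℝ → ℝ} {L : ℝ}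

/-- The inner parallel map has Jacobian determinant `-(1 - q k)`. -/
theorem exists_hasFDerivAt_normalMap (h : IsPositiveLoop e φ φ' γ θ ς k L) (p : ℝ × ℝ) :
    ∃ D : ℝ × ℝ →L[ℝ] ℝ × ℝ,
      HasFDerivAt (fun p : ℝ × ℝ => e (γ p.1 - p.2 • φ (θ p.1))) D p ∧
      |D.det| = |1 - p.2 * k p.1| := by
  set s := p.1
  set u := e (φ' (θ s)) with hu
  set v := e (φ (θ s)) with hv
  set a := ς s * (1 - p.2 * k s) with ha
  -- The columns are the partial derivatives `ς (1 - q k) φ'` and `-φ`.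
  refine ⟨(Matrix.toLin (.finTwoProd ℝ) (.finTwoProd ℝ)
    !![a * u.1, -v.1; a * u.2, -v.2]).toContinuousLinearMap, ?_, ?_⟩
  · rw [Matrix.toLin_finTwoProd_toContinuousLinearMap]
    let E₁ : X →L[ℝ] ℝ := (ContinuousLinearMap.fst ℝ ℝ ℝ).comp (e : X →L[ℝ] ℝ × ℝ)
    let E₂ : X →L[ℝ] ℝ := (ContinuousLinearMap.snd ℝ ℝ ℝ).comp (e : X →L[ℝ] ℝ × ℝ)
    have key : ∀ E : X →L[ℝ] ℝ, HasFDerivAt (fun p : ℝ × ℝ => E (γ p.1) - p.2 * E (φ (θ p.1)))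
        ((a * E (φ' (θ s))) • ContinuousLinearMap.fst ℝ ℝ ℝ +
          (-E (φ (θ s))) • ContinuousLinearMap.snd ℝ ℝ ℝ) p := by
      intro E
      have h1 := (E.hasFDerivAt.comp_hasDerivAt s (h.hasDerivAt s)).comp_hasFDerivAt p
        (hasFDerivAt_fst (𝕜 := ℝ))
      have h2 := (E.hasFDerivAt.comp_hasDerivAt s
        ((h.circle.hasDerivAt (θ s)).scomp s (h.hasDerivAt_angle s))).comp_hasFDerivAt p
        (hasFDerivAt_fst (𝕜 := ℝ))
      refine (h1.sub ((hasFDerivAt_snd (𝕜 := ℝ)).mul h2)).congr_fderiv ?_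
      ext
      · simp [s, ha]
        ring
      · simp [s]
    refine ((key E₁).prodMk (key E₂)).congr_of_eventuallyEq (Eventually.of_forall fun q => ?_)
    ext <;> simp [E₁, E₂]
  · simp only [LinearMap.det_toContinuousLinearMap, LinearMap.det_toLin, Matrix.det_fin_two_of]
    have h4 := h.antinorm_speed s
    rw [crossForm_apply, cross, ← hu, ← hv] at h4
    congr 1
    rw [ha]
    linear_combination (1 - p.2 * k s) * h4

/-- Area bound for a set swept out by inner normals of length at most `m`. -/
theorem volume_image_normalMap_le (h : IsPositiveLoop e φ φ' γ θ ς k L) {m : ℝ → ℝ}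
    (hm : Continuous m) (hm0 : ∀ s, 0 ≤ m s) (hmk : ∀ s, m s * k s ≤ 1) {D : Set X}
    (hD : ∀ x ∈ D, ∃ s ∈ Ico 0 L, ∃ r ∈ Icc 0 (m s), γ s - x = r • φ (θ s)) :
    volume (e '' D) ≤ ENNReal.ofReal (∫ s in (0:ℝ)..L, (m s - m s ^ 2 * k s / 2)) := by
  choose J hJ hdet using h.exists_hasFDerivAt_normalMap
  have hkc := h.continuous_curvature
  set S := {p : ℝ × ℝ | p.1 ∈ Ico 0 L ∧ p.2 ∈ Icc 0 (m p.1)} with hS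
  have hSm : MeasurableSet S :=
    (measurable_fst measurableSet_Ico).inter
      ((measurableSet_le measurable_const measurable_snd).inter
        (measurableSet_le measurable_snd (hm.measurable.comp measurable_fst)))
  have hsub : e '' D ⊆ (fun p : ℝ × ℝ => e (γ p.1 - p.2 • φ (θ p.1))) '' S := by
    rintro _ ⟨x, hx, rfl⟩
    obtain ⟨s, hs, r, hr, heq⟩ := hD x hx
    exact ⟨(s, r), ⟨hs, hr⟩, by simp only [← heq, sub_sub_cancel]⟩
  have hc : Continuous fun s => m s - m s ^ 2 * k s / 2 := by fun_prop
  calc volume (e '' D) ≤ volume ((fun p : ℝ × ℝ => e (γ p.1 - p.2 • φ (θ p.1))) '' S) :=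
        measure_mono hsub
    _ ≤ ∫⁻ p in S, ENNReal.ofReal |(J p).det| :=
        addHaar_image_le_lintegral_abs_det_fderiv _ hSm fun p _ => (hJ p).hasFDerivWithinAt
    _ = ∫⁻ p in S, ENNReal.ofReal |1 - p.2 * k p.1| := by simp only [hdet]
    _ = ∫⁻ s in Ico 0 L, ∫⁻ q in Icc 0 (m s), ENNReal.ofReal |1 - q * k s| :=
        setLIntegral_subgraph hm.measurable
          (g := fun p : ℝ × ℝ => ENNReal.ofReal |1 - p.2 * k p.1|)
          (ENNReal.continuous_ofReal.comp (f := fun p : ℝ × ℝ => |1 - p.2 * k p.1|)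
            (by fun_prop)).measurable _ measurableSet_Ico
    _ = ∫⁻ s in Ico 0 L, ENNReal.ofReal (m s - m s ^ 2 * k s / 2) := by
        simp only [setLIntegral_abs_one_sub_mul (h.curvature_pos _).le (hm0 _) (hmk _)]
    _ = ∫⁻ s in Ioc 0 L, ENNReal.ofReal (m s - m s ^ 2 * k s / 2) := by
        rw [restrict_Ico_eq_restrict_Ioc]
    _ = ENNReal.ofReal (∫ s in (0:ℝ)..L, (m s - m s ^ 2 * k s / 2)) := by
        rw [intervalIntegral.integral_of_le h.length_pos.le,
          ofReal_integral_eq_lintegral_ofReal hc.integrableOn_Ioc]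
        refine Eventually.of_forall fun s => ?_
        have := mul_le_mul_of_nonneg_left (hmk s) (hm0 s)
        have := hm0 s
        simp only [Pi.zero_apply]
        nlinarith

/-- Lower area bound for the disk bounded by a loop which is a circle of the norm. -/
theorem le_volume_image_ball (h : IsPositiveLoop e φ φ' γ θ ς k L) {p : X} {r : ℝ} (hr : 0 < r)
    (hγ : ∀ s, γ s = p + r • φ (θ s)) (hk : ∀ s, k s = r⁻¹) :
    ENNReal.ofReal (L * (r / 2)) ≤ volume (e '' Metric.ball p r) := by
  choose J hJ hdet using h.exists_hasFDerivAt_normalMap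
  set F := fun p : ℝ × ℝ => e (γ p.1 - p.2 • φ (θ p.1)) with hF
  have hF' : ∀ z, F z = e (p + (r - z.2) • φ (θ z.1)) := fun z => by
    simp only [hF, hγ, sub_smul]
    congr 1
    abel
  set S := Ico 0 L ×ˢ Ioo 0 r with hS
  have hSm : MeasurableSet S := measurableSet_Ico.prod measurableSet_Ioo
  have hn : ∀ z ∈ S, ‖(r - z.2) • φ (θ z.1)‖ = r - z.2 := fun z hz => by
    rw [norm_smul, h.circle.norm_eq, mul_one, Real.norm_eq_abs,
      abs_of_pos (sub_pos.2 hz.2.2)]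
  -- The distance to `p` recovers `q`, the direction recovers `φ (θ s)`, and simplicity of the curve
  -- recovers `s`.
  have hinj : InjOn F S := by
    intro z hz z' hz' heq
    rw [hF', hF'] at heq
    have h1 := add_left_cancel (e.injective heq)
    have h2 : r - z.2 = r - z'.2 := by rw [← hn z hz, ← hn z' hz', h1]
    have h3 : φ (θ z.1) = φ (θ z'.1) := by
      rw [h2] at h1
      exact smul_right_injective X (sub_pos.2 hz'.2.2).ne' h1
    have h4 : z.1 = z'.1 := h.injOn hz.1 hz'.1 (by rw [hγ, hγ, h3])
    exact Prod.ext h4 (by linarith)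
  have hsub : F '' S ⊆ e '' Metric.ball p r := by
    rintro _ ⟨z, hz, rfl⟩
    refine ⟨p + (r - z.2) • φ (θ z.1), ?_, (hF' z).symm⟩
    rw [Metric.mem_ball, dist_eq_norm, add_sub_cancel_left, hn z hz]
    linarith [hz.2.1]
  calc ENNReal.ofReal (L * (r / 2))
      = ∫⁻ s in Ico 0 L, ∫⁻ q in Ioo 0 r, ENNReal.ofReal |1 - q * r⁻¹| := by
        rw [restrict_Ioo_eq_restrict_Icc (μ := volume) (a := 0) (b := r),
          setLIntegral_abs_one_sub_mul (inv_pos.2 hr).le hr.le (mul_inv_cancel₀ hr.ne').le,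
          setLIntegral_const, Real.volume_Ico, sub_zero, mul_comm L,
          ENNReal.ofReal_mul (by positivity)]
        congr 2
        field_simp
        ring
    _ = ∫⁻ z in S, ENNReal.ofReal |1 - z.2 * k z.1| := by
        simp only [hk]
        rw [hS, Measure.volume_eq_prod, ← Measure.prod_restrict, lintegral_prod]
        exact (ENNReal.continuous_ofReal.comp (f := fun z : ℝ × ℝ => |1 - z.2 * r⁻¹|)
          (by fun_prop)).aemeasurable
    _ = ∫⁻ z in S, ENNReal.ofReal |(J z).det| := by simp only [hdet]
    _ = volume (F '' S) := lintegral_abs_det_fderiv_eq_addHaar_image _ hSm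
        (fun z _ => (hJ z).hasFDerivWithinAt) hinj
    _ ≤ volume (e '' Metric.ball p r) := measure_mono hsub

end IsPositiveLoop

/-! ### The area inequality and its equality case -/

theorem eq_zero_of_integral_nonpos {g : ℝ → ℝ} {L : ℝ} (hL : 0 < L) (hg : Continuous g)
    (h0 : ∀ s ∈ Icc 0 L, 0 ≤ g s) (hI : ∫ s in (0:ℝ)..L, g s ≤ 0) : ∀ s ∈ Icc 0 L, g s = 0 := by
  intro s hs
  by_contra hne
  exact absurd (intervalIntegral.integral_pos hL hg.continuousOn
    (fun x hx => h0 x (Ioc_subset_Icc_self hx)) ⟨s, hs, lt_of_le_of_ne (h0 s hs) (Ne.symm hne)⟩)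
    (not_lt.2 hI)

namespace IsPositiveLoop

variable {X : Type*} [NormedAddCommGroup X] [NormedSpace ℝ X]
  {e : X ≃L[ℝ] ℝ × ℝ} {φ φ' γ : ℝ → X} {θ ς k : ℝ → ℝ} {L : ℝ}

theorem continuous_radius (h : IsPositiveLoop e φ φ' γ θ ς k L) : Continuous fun s => (k s)⁻¹ :=
  h.continuous_curvature.inv₀ fun s => (h.curvature_pos s).ne'

theorem integral_curvature_pos (h : IsPositiveLoop e φ φ' γ θ ς k L) :
    0 < ∫ s in (0:ℝ)..L, k s :=
  intervalIntegral.intervalIntegral_pos_of_pos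
    (h.continuous_curvature.intervalIntegrable _ _) h.curvature_pos h.length_pos

/-- Completing the square: the pointwise loss from stopping the normal at length `m` instead of at
the focal distance `1 / k`. -/
theorem radius_sub_eq (h : IsPositiveLoop e φ φ' γ θ ς k L) (s m : ℝ) :
    1 / k s - 2 * (m - m ^ 2 * k s / 2) = k s * ((k s)⁻¹ - m) ^ 2 := by
  have := (h.curvature_pos s).ne'
  field_simp
  ring

variable [StrictConvexSpace ℝ X]

/-- Heintze–Karcher type area bound, with inner normals cut at the length over the total
curvature. -/
theorem area_le (h : IsPositiveLoop e φ φ' γ θ ς k L) {R : ℝ}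
    (hR : R = L / ∫ s in (0:ℝ)..L, k s) :
    volume (e '' enclosedRegion (range γ)) ≤ ENNReal.ofReal
      (∫ s in (0:ℝ)..L, (min R (k s)⁻¹ - min R (k s)⁻¹ ^ 2 * k s / 2)) := by
  have hK := h.integral_curvature_pos
  have hR0 : 0 < R := by rw [hR]; exact div_pos h.length_pos hK
  refine h.volume_image_normalMap_le (continuous_const.min h.continuous_radius)
    (fun s => le_min hR0.le (inv_pos.2 (h.curvature_pos s)).le) (fun s => ?_) fun x hx => ?_
  · have := mul_le_mul_of_nonneg_right (min_le_right R (k s)⁻¹) (h.curvature_pos s).le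
    rwa [inv_mul_cancel₀ (h.curvature_pos s).ne'] at this
  · obtain ⟨s, hs, r, hr0, heq, hr⟩ := h.exists_foot hx
    refine ⟨s, hs, r, ⟨hr0, le_min ?_ ?_⟩, heq⟩
    · rw [hR, le_div_iff₀ hK]
      exact h.mul_integral_curvature_le hr
    · rw [← one_div, le_div_iff₀ (h.curvature_pos s)]
      exact h.mul_curvature_le_one heq hr

/-- The area deficit is at least a weighted square norm of `1 / k - min R (1 / k)`. -/
theorem integral_deficit_le (h : IsPositiveLoop e φ φ' γ θ ς k L) {R : ℝ}
    (hR : R = L / ∫ s in (0:ℝ)..L, k s) :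
    ∫ s in (0:ℝ)..L, k s * ((k s)⁻¹ - min R (k s)⁻¹) ^ 2 ≤
      (∫ s in (0:ℝ)..L, 1 / k s) -
        2 * (volume (e '' enclosedRegion (range γ))).toReal := by
  have hm : Continuous fun s => min R (k s)⁻¹ := continuous_const.min h.continuous_radius
  have hkc := h.continuous_curvature
  have hR0 : 0 ≤ R := by rw [hR]; exact (div_pos h.length_pos h.integral_curvature_pos).le
  have hc : Continuous fun s => min R (k s)⁻¹ - min R (k s)⁻¹ ^ 2 * k s / 2 := by fun_prop
  have h1 : Continuous fun s => 1 / k s := by simpa [one_div] using h.continuous_radius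
  have hA := ENNReal.toReal_le_of_le_ofReal (intervalIntegral.integral_nonneg h.length_pos.le
    fun s _ => ?_) (h.area_le hR)
  · simp only [← h.radius_sub_eq]
    rw [intervalIntegral.integral_sub (h1.intervalIntegrable _ _)
      ((hc.const_mul 2).intervalIntegrable _ _), intervalIntegral.integral_const_mul]
    linarith
  · have h2 : 0 ≤ min R (k s)⁻¹ := le_min hR0 (inv_pos.2 (h.curvature_pos s)).le
    have h3 : min R (k s)⁻¹ * k s ≤ 1 := by
      have := mul_le_mul_of_nonneg_right (min_le_right R (k s)⁻¹) (h.curvature_pos s).le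
      rwa [inv_mul_cancel₀ (h.curvature_pos s).ne'] at this
    nlinarith [mul_le_mul_of_nonneg_left h3 h2]

theorem two_mul_area_le (h : IsPositiveLoop e φ φ' γ θ ς k L) :
    2 * (volume (e '' enclosedRegion (range γ))).toReal ≤ ∫ s in (0:ℝ)..L, 1 / k s := by
  have h1 := h.integral_deficit_le rfl
  have h2 : 0 ≤ ∫ s in (0:ℝ)..L,
      k s * ((k s)⁻¹ - min (L / ∫ s in (0:ℝ)..L, k s) (k s)⁻¹) ^ 2 :=
    intervalIntegral.integral_nonneg h.length_pos.le fun s _ =>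
      mul_nonneg (h.curvature_pos s).le (sq_nonneg _)
  linarith

theorem eq_sphere_of_two_mul_area_eq (h : IsPositiveLoop e φ φ' γ θ ς k L)
    (heq : 2 * (volume (e '' enclosedRegion (range γ))).toReal = ∫ s in (0:ℝ)..L, 1 / k s) :
    ∃ (p : X) (r : ℝ), 0 < r ∧ range γ = Metric.sphere p r := by
  have hL := h.length_pos
  have hK := h.integral_curvature_pos
  have hkc := h.continuous_curvature
  have hρ := h.continuous_radius
  obtain ⟨R, hR⟩ : ∃ R, R = L / ∫ s in (0:ℝ)..L, k s := ⟨_, rfl⟩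
  have hR0 : 0 < R := by rw [hR]; exact div_pos hL hK
  have hdef := h.integral_deficit_le hR
  rw [heq, sub_self] at hdef
  have hmin := eq_zero_of_integral_nonpos hL (by fun_prop)
    (fun s _ => mul_nonneg (h.curvature_pos s).le (sq_nonneg _)) hdef
  have hle : ∀ s ∈ Icc 0 L, 0 ≤ R * k s - 1 := by
    intro s hs
    have hk0 := h.curvature_pos s
    have h1 := pow_eq_zero_iff (two_ne_zero) |>.1 ((mul_eq_zero.1 (hmin s hs)).resolve_left hk0.ne')
    have h2 : (k s)⁻¹ ≤ R := by
      rw [sub_eq_zero.1 h1]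
      exact min_le_left _ _
    have := mul_le_mul_of_nonneg_right h2 hk0.le
    rw [inv_mul_cancel₀ hk0.ne'] at this
    linarith
  -- By the choice of `R`, the nonnegative function `R k - 1` has integral zero.
  have hRk := eq_zero_of_integral_nonpos hL (g := fun s => R * k s - 1) (by fun_prop) hle (by
    rw [intervalIntegral.integral_sub ((hkc.const_mul R).intervalIntegrable _ _) (by simp),
      intervalIntegral.integral_const_mul, hR, div_mul_cancel₀ _ hK.ne']
    simp)
  have hd : ∀ s, HasDerivAt (fun s => γ s - R • φ (θ s))
      (-(ς s * (R * k s - 1)) • φ' (θ s)) s := fun s => by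
    refine ((h.hasDerivAt s).sub (((h.circle.hasDerivAt (θ s)).scomp s
      (h.hasDerivAt_angle s)).const_smul R)).congr_deriv ?_
    rw [smul_smul, ← sub_smul]
    congr 1
    ring
  have hconst := constant_of_has_deriv_right_zero (f := fun s => γ s - R • φ (θ s))
    (a := 0) (b := L) (fun s _ => (hd s).continuousAt.continuousWithinAt) (fun s hs => by
      have := hd s
      rw [hRk s (Ico_subset_Icc_self hs), mul_zero, neg_zero, zero_smul] at this
      exact this.hasDerivWithinAt)
  set p := γ 0 - R • φ (θ 0) with hp
  have hγ : ∀ s ∈ Icc 0 L, γ s = p + R • φ (θ s) := fun s hs => by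
    rw [← hconst s hs]; simp
  refine ⟨p, R, hR0, subset_antisymm ?_ ?_⟩
  · rintro _ ⟨t, rfl⟩
    obtain ⟨s, hs, hst⟩ := h.periodic.exists_mem_Ico₀ hL t
    rw [hst, hγ s (Ico_subset_Icc_self hs), mem_sphere_iff_norm, add_sub_cancel_left, norm_smul,
      h.circle.norm_eq, Real.norm_eq_abs, abs_of_pos hR0, mul_one]
  · intro y hy
    rw [mem_sphere_iff_norm] at hy
    obtain ⟨τ, hτ⟩ := h.circle.surj (R⁻¹ • (y - p)) (by
      rw [norm_smul, hy, Real.norm_eq_abs, abs_of_pos (inv_pos.2 hR0), inv_mul_cancel₀ hR0.ne'])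
    obtain ⟨t, ht⟩ := h.exists_angle_eq τ
    have hper : Function.Periodic (fun s => φ (θ s)) L := h.angle_periodic
    obtain ⟨s, hs, hst⟩ := hper.exists_mem_Ico₀ hL t
    refine ⟨s, ?_⟩
    rw [hγ s (Ico_subset_Icc_self hs), ← hst, ht, hτ, smul_inv_smul₀ hR0.ne']
    abel

theorem two_mul_area_eq_of_sphere (h : IsPositiveLoop e φ φ' γ θ ς k L) {p : X} {r : ℝ}
    (hr : 0 < r) (hΓ : range γ = Metric.sphere p r) :
    2 * (volume (e '' enclosedRegion (range γ))).toReal = ∫ s in (0:ℝ)..L, 1 / k s := by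
  have hnorm : ∀ s, ‖γ s - p‖ = r := fun s => by
    rw [← mem_sphere_iff_norm, ← hΓ]
    exact mem_range_self s
  -- The point `p + r • φ (θ s)` is on the curve, hence in the tangent half-plane at `s`. This makes
  -- `γ s - p`, of norm `r`, attain equality in the support inequality.
  have hγ : ∀ s, γ s = p + r • φ (θ s) := by
    intro s
    obtain ⟨t, ht⟩ : p + r • φ (θ s) ∈ range γ := by
      rw [hΓ, mem_sphere_iff_norm, add_sub_cancel_left, norm_smul, h.circle.norm_eq,
        Real.norm_eq_abs, abs_of_pos hr, mul_one]
    have h1 := h.crossForm_sub_nonpos s t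
    rw [ht] at h1
    have h2 := h.circle.eq_of_le_crossForm (u := θ s) (x := γ s - p) (by
      rw [hnorm]
      simp only [map_sub, map_add, map_smul, smul_eq_mul] at h1 ⊢
      linarith)
    rw [hnorm] at h2
    rw [← h2]
    abel
  have hk : ∀ s, k s = r⁻¹ := by
    intro s
    have h1 : HasDerivAt γ (r • ((k s * ς s) • φ' (θ s))) s := by
      rw [show γ = fun s => p + r • φ (θ s) from funext hγ]
      exact (((h.circle.hasDerivAt (θ s)).scomp s (h.hasDerivAt_angle s)).const_smul r).const_add p
    have h2 := h1.unique (h.hasDerivAt s)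
    rw [smul_smul] at h2
    have h3 := smul_left_injective ℝ (h.circle.deriv_ne_zero (θ s)) h2
    have h4 := h.speed_pos s
    have h5 : r * k s = 1 := mul_right_cancel₀ h4.ne' (by linarith)
    exact eq_inv_of_mul_eq_one_right h5
  have hup := h.two_mul_area_le
  refine le_antisymm hup ?_
  have hlow := (h.le_volume_image_ball hr hγ hk).trans
    (measure_mono (image_mono (ball_subset_enclosedRegion_sphere p r)))
  rw [← hΓ] at hlow
  have hfin : volume (e '' enclosedRegion (range γ)) ≠ ⊤ :=
    ne_top_of_le_ne_top ENNReal.ofReal_ne_top (h.area_le rfl)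
  have := (ENNReal.ofReal_le_iff_le_toReal hfin).1 hlow
  simp only [hk, one_div, inv_inv, intervalIntegral.integral_const, smul_eq_mul, sub_zero]
  linarith

end IsPositiveLoop

/-! ### Adapted coordinates and reduction to a positive loop -/

section Frame

variable {X : Type*} [NormedAddCommGroup X] [NormedSpace ℝ X]

theorem alternatingMap_eq_mul_cross (Ω : X [⋀^Fin 2]→ₗ[ℝ] ℝ) (e : X ≃L[ℝ] ℝ × ℝ) (x y : X) :
    Ω ![x, y] = Ω ![e.symm (1, 0), e.symm (0, 1)] * cross (e x) (e y) := by
  let b := (Module.Basis.finTwoProd ℝ).map e.symm.toLinearEquiv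
  have hb : (⇑b : Fin 2 → X) = ![e.symm (1, 0), e.symm (0, 1)] := by
    ext i
    fin_cases i <;> simp [b]
  conv_lhs => rw [Ω.eq_smul_basis_det b]
  rw [AlternatingMap.smul_apply, hb, Module.Basis.det_apply, Matrix.det_fin_two, smul_eq_mul]
  simp [Module.Basis.toMatrix_apply, b, cross]
  left
  ring

/-- Linear coordinates in which the area form is standard up to sign and the unit circle is
positively oriented. -/
theorem exists_frame [FiniteDimensional ℝ X] [Fact (Module.finrank ℝ X = 2)]
    (Ω : X [⋀^Fin 2]→ₗ[ℝ] ℝ) (hΩ : Ω ≠ 0) {φ : ℝ → X} (hφ : IsUnitCircleParam φ) :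
    ∃ (e : X ≃L[ℝ] ℝ × ℝ) (ε : ℝ), |ε| = 1 ∧ (∀ x y, Ω ![x, y] = ε * cross (e x) (e y)) ∧
      IsOrientedCircle e φ (deriv φ) := by
  let e₀ : X ≃L[ℝ] ℝ × ℝ := ContinuousLinearEquiv.ofFinrankEq (by
    rw [Fact.out (p := Module.finrank ℝ X = 2)]; simp)
  set c := Ω ![e₀.symm (1, 0), e₀.symm (0, 1)] with hc
  have hΩc : ∀ x y, Ω ![x, y] = c * cross (e₀ x) (e₀ y) := alternatingMap_eq_mul_cross Ω e₀
  have hc0 : c ≠ 0 := by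
    intro h0
    apply hΩ
    ext v
    have : v = ![v 0, v 1] := by ext i; fin_cases i <;> rfl
    rw [this, hΩc, h0]
    simp
  have hd : ∀ t, HasDerivAt φ (deriv φ t) t := fun t =>
    (hφ.smooth.differentiable (by simp) t).hasDerivAt
  have hcd : Continuous (deriv φ) := hφ.smooth.continuous_deriv (by simp)
  have hn : ∀ t, ‖φ t‖ = 1 := fun t => by
    rw [← mem_sphere_zero_iff_norm, ← hφ.range_eq]
    exact mem_range_self t
  have h0 : ∀ t, deriv φ t ≠ 0 := fun t => by
    rw [← norm_ne_zero_iff, hφ.unit_speed]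
    norm_num
  have hw : ∀ t, crossForm e₀ (deriv φ t) (φ t) ≠ 0 := fun t =>
    (crossForm_deriv_support e₀ hd hn h0 t).1
  have hwc : Continuous fun t => crossForm e₀ (deriv φ t) (φ t) :=
    continuous_crossForm e₀ hφ.smooth.continuous hcd
  -- Scaling the first coordinate by `a` multiplies the standard form by `a`. Its size `|c|`
  -- normalizes the area; its sign corrects the orientation, which is constant because the form
  -- never vanishes along `φ`.
  obtain ⟨a, ha0, hac, haw⟩ : ∃ a : ℝ, a ≠ 0 ∧ |c / a| = 1 ∧
      ∀ t, 0 < a * crossForm e₀ (deriv φ t) (φ t) := by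
    have hc1 : |c / (|c|)| = 1 := by rw [abs_div, abs_abs, div_self (abs_ne_zero.2 hc0)]
    have hcp := abs_pos.2 hc0
    by_cases hall : ∀ t, 0 < crossForm e₀ (deriv φ t) (φ t)
    · exact ⟨|c|, hcp.ne', hc1, fun t => mul_pos hcp (hall t)⟩
    · push Not at hall
      obtain ⟨t₀, ht₀⟩ := hall
      refine ⟨-|c|, neg_ne_zero.2 hcp.ne', by rwa [div_neg, abs_neg], fun t => ?_⟩
      refine mul_pos_of_neg_of_neg (neg_neg_of_pos hcp) ?_
      by_contra! hge
      obtain ⟨u, -, hu⟩ := intermediate_value_uIcc (a := t₀) (b := t) hwc.continuousOn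
        (Icc_subset_uIcc ⟨ht₀, hge⟩)
      exact hw u hu
  let S : (ℝ × ℝ) ≃L[ℝ] ℝ × ℝ :=
    ((LinearEquiv.smulOfNeZero ℝ ℝ a ha0).prodCongr (LinearEquiv.refl ℝ ℝ)).toContinuousLinearEquiv
  have hS : ∀ z, S z = (a * z.1, z.2) := fun z => rfl
  have hcross : ∀ z w, cross (S z) (S w) = a * cross z w := fun z w => by
    simp only [hS, cross]
    ring
  refine ⟨e₀.trans S, c / a, hac, fun x y => ?_, hd, hcd, hn, fun x hx => ?_, fun t => ?_⟩
  · rw [hΩc, ContinuousLinearEquiv.trans_apply, ContinuousLinearEquiv.trans_apply, hcross]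
    field_simp
  · have : x ∈ range φ := by rw [hφ.range_eq]; simpa using hx
    exact this
  · have := haw t
    rw [crossForm_apply, ← hcross] at this
    rwa [crossForm_apply]

/-- The anti-norm of a tangent vector of the unit circle. -/
theorem antinorm_smul_deriv {Ω : X [⋀^Fin 2]→ₗ[ℝ] ℝ} {e : X ≃L[ℝ] ℝ × ℝ} {ε : ℝ} (hε : |ε| = 1)
    (hΩ : ∀ x y, Ω ![x, y] = ε * cross (e x) (e y)) {φ φ' : ℝ → X}
    (h : IsOrientedCircle e φ φ') {a : ℝ} (ha : 0 < a) (t : ℝ) :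
    antinorm Ω (a • φ' t) = a * crossForm e (φ' t) (φ t) := by
  have hform : ∀ y, Ω ![a • φ' t, y] = -(ε * a) * crossForm e (φ' t) y := fun y => by
    rw [hΩ, crossForm_apply, map_smul, cross, cross]
    simp
    ring
  have hle := (crossForm_deriv_support e h.hasDerivAt h.norm_eq h.deriv_ne_zero t).2
  rw [abs_of_pos (h.pos t)] at hle
  -- The supremum is attained at `φ t` up to the sign that cancels `-ε`.
  refine IsGreatest.csSup_eq ⟨⟨-ε • φ t, ?_, ?_⟩, ?_⟩
  · rw [mem_sphere_zero_iff_norm, norm_smul, h.norm_eq, norm_neg, Real.norm_eq_abs, hε, mul_one]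
  · have : ε * ε = 1 := by rw [← abs_mul_abs_self, hε, mul_one]
    simp only [hform, map_smul, smul_eq_mul]
    linear_combination a * crossForm e (φ' t) (φ t) * this
  · rintro _ ⟨y, hy, rfl⟩
    rw [mem_sphere_zero_iff_norm] at hy
    have h1 := hle y
    rw [hy, mul_one] at h1
    simp only [hform]
    refine (le_abs_self _).trans ?_
    rw [abs_mul, abs_neg, abs_mul, hε, one_mul, abs_of_pos ha]
    exact mul_le_mul_of_nonneg_left h1 ha.le

/-- By the chain rule the angle is `t ∘ σ` and the norm speed is `deriv σ`; unit anti-norm speed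
becomes the normalization of the speed against the support value. -/
theorem exists_isPositiveLoop {Ω : X [⋀^Fin 2]→ₗ[ℝ] ℝ} {e : X ≃L[ℝ] ℝ × ℝ} {ε : ℝ} (hε : |ε| = 1)
    (hΩ : ∀ x y, Ω ![x, y] = ε * cross (e x) (e y)) {φ : ℝ → X}
    (h : IsOrientedCircle e φ (deriv φ)) {γ : ℝ → X} {L : ℝ}
    (hγ : IsSimpleClosedAntinormCurve Ω γ L) {k : ℝ → ℝ} (hk : IsCircularCurvature φ γ k)
    (hpos : ∀ s, 0 < k s) :
    ∃ θ ς : ℝ → ℝ, IsPositiveLoop e φ (deriv φ) γ θ ς k L := by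
  obtain ⟨c, σ, κ, hc, -, hσ, hσ', hγc, ⟨t, ht, hct, hκ⟩, hkκ⟩ := hk
  have hk' : ∀ s, k s = deriv t (σ s) := fun s => by rw [hkκ, hκ]
  have hσd : ∀ s, HasDerivAt σ (deriv σ s) s := fun s =>
    (hσ.differentiable (by simp) s).hasDerivAt
  have hd : ∀ s, HasDerivAt γ (deriv σ s • deriv φ (t (σ s))) s := fun s => by
    rw [show γ = c ∘ σ from funext hγc, ← hct]
    exact ((hc.differentiable (by simp) _).hasDerivAt).scomp s (hσd s)
  refine ⟨fun s => t (σ s), deriv σ, h, hd, fun s => ?_, hσ.continuous_deriv (by simp), ?_,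
    hσ', hpos, fun s => ?_, hγ.length_pos, hγ.periodic, hγ.simple⟩
  · rw [hk']
    exact ((ht.differentiable (by simp) _).hasDerivAt).comp s (hσd s)
  · rw [show k = fun s => deriv t (σ s) from funext hk']
    exact (ht.continuous_deriv (by simp)).comp hσ.continuous
  · rw [← antinorm_smul_deriv hε hΩ h (hσ' s), ← (hd s).deriv]
    exact hγ.unit_speed s

end Frame

end NormedPlane

theorem theorem4p4 {X : Type*} [NormedAddCommGroup X] [NormedSpace ℝ X]
    [FiniteDimensional ℝ X] [Fact (Module.finrank ℝ X = 2)] [StrictConvexSpace ℝ X]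
    [MeasurableSpace X] [BorelSpace X]
    (Ω : X [⋀^Fin 2]→ₗ[ℝ] ℝ) (hΩ : Ω ≠ 0)
    (φ : ℝ → X) (hφ : NormedPlane.IsUnitCircleParam φ)
    (γ : ℝ → X) (L : ℝ) (hγ : NormedPlane.IsSimpleClosedAntinormCurve Ω γ L)
    (k : ℝ → ℝ) (hk : NormedPlane.IsCircularCurvature φ γ k) (hpos : ∀ s, 0 < k s) :
    2 * Ω.measure.real (NormedPlane.enclosedRegion (Set.range γ)) ≤ ∫ s in (0 : ℝ)..L, 1 / k s ∧
    (2 * Ω.measure.real (NormedPlane.enclosedRegion (Set.range γ)) = ∫ s in (0 : ℝ)..L, 1 / k s ↔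
      ∃ (p : X) (r : ℝ), 0 < r ∧ Set.range γ = Metric.sphere p r) := by
  obtain ⟨e, ε, hε, hΩe, hcirc⟩ := NormedPlane.exists_frame Ω hΩ hφ
  obtain ⟨θ, ς, h⟩ := NormedPlane.exists_isPositiveLoop hε hΩe hcirc hγ hk hpos
  rw [MeasureTheory.measureReal_def, NormedPlane.alternatingMap_measure_eq_volume_image Ω e
    fun x y => by rw [hΩe, abs_mul, hε, one_mul]]
  exact ⟨h.two_mul_area_le, h.eq_sphere_of_two_mul_area_eq,
    fun ⟨_, _, hr, hΓ⟩ => h.two_mul_area_eq_of_sphere hr hΓ⟩
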